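/- Finite types are generated from the type $0$ of natural numbers by $\sigma\to\tau$ and $\sigma^*$ (finite sequences of objects of type $\sigma$). Let $\mathsf{E\text{-}HA}^{\omega}$ be extensional Heyting arithmetic in these types (with combinators, recursors, the empty sequence, prepending, list recursors, and the axiom that every sequence is empty or obtained by prepending). Its only primitive equality is that of type $0$; equality at higher types is defined extensionally, sequences being equal when they have the same length and equal components, and the extensionality axioms $x=_\sigma y\to zx=_\tau zy$ are included. Write $x\in s$ if $x$ equals a component of the sequence $s$. Add to the language predicates $\mathrm{st}^\sigma$ and quantifiers $\forall^{\mathrm{st}}x^\sigma,\exists^{\mathrm{st}}x^\sigma$ for all types $\sigma$; formulas without these symbols are called internal. Induction in $\mathsf{E\text{-}HA}^{\omega}$ is for internal formulas only. $\mathsf{E\text{-}PA}^{\omega,\mathrm{st}}$ is the system obtained from $\mathsf{E\text{-}HA}^{\omega}$ by adding, for all formulas $\Phi$ of the extended language (possibly with further free variables), the law of excluded middle; the axioms $\forall^{\mathrm{st}}x\,\Phi\leftrightarrow\forall x(\mathrm{st}(x)\to\Phi)$ and $\exists^{\mathrm{st}}x\,\Phi\leftrightarrow\exists x(\mathrm{st}(x)\wedge\Phi)$;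 the axioms $\mathrm{st}(x)\wedge x=y\to\mathrm{st}(y)$, $\mathrm{st}(t)$ for closed terms $t$, and $\mathrm{st}(f)\wedge\mathrm{st}(x)\to\mathrm{st}(fx)$; and external induction $\Phi(0)\wedge\forall^{\mathrm{st}}n^0(\Phi(n)\to\Phi(n+1))\to\forall^{\mathrm{st}}n^0\,\Phi(n)$. Let $\mathsf P$ be $\mathsf{E\text{-}PA}^{\omega,\mathrm{st}}$ together with, for all types $\sigma,\tau$ and all internal formulas $\varphi(x^\sigma,y^\tau)$, possibly with further free variables, $$\mathsf I:\ \forall^{\mathrm{st}}x'^{\sigma^*}\,\exists y^\tau\,\forall x\in x'\,\varphi(x,y)\to\exists y^\tau\,\forall^{\mathrm{st}}x^\sigma\,\varphi(x,y),$$ $$\mathsf{HAC}_{\mathrm{int}}:\ \forall^{\mathrm{st}}x^\sigma\,\exists^{\mathrm{st}}y^\tau\,\varphi(x,y)\to\exists^{\mathrm{st}}F^{\sigma\to\tau^*}\,\forall^{\mathrm{st}}x^\sigma\,\exists y\in F(x)\,\varphi(x,y).$$ For types $\sigma$ and arbitrary formulas $\Phi(n^0,x^\sigma)$ of the extended language,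 possibly with further free variables, consider the schemas $$\mathsf{AC}_0^{\mathrm{st}}:\ \forall^{\mathrm{st}}n^0\,\exists^{\mathrm{st}}x^\sigma\,\Phi(n,x)\to\exists^{\mathrm{st}}f^{0\to\sigma}\,\forall^{\mathrm{st}}n^0\,\Phi(n,f(n)),$$ $$\mathsf{CSAT}:\ \forall^{\mathrm{st}}n^0\,\exists x^\sigma\,\Phi(n,x)\to\exists f^{0\to\sigma}\,\forall^{\mathrm{st}}n^0\,\Phi(n,f(n)).$$ **Theorem.** $\mathsf P\vdash\mathsf{AC}_0^{\mathrm{st}}\to\mathsf{CSAT}$; that is, every instance of the schema $\mathsf{CSAT}$ is derivable in $\mathsf P$ extended with the schema $\mathsf{AC}_0^{\mathrm{st}}$. -/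

import Mathlib

namespace NSArith

/-! ## Finite types, terms and formulas -/

/-- The finite types: the type `0` of natural numbers, function types, and types `σ*` of finite
sequences of objects of type `σ`. -/
inductive Ty : Type
  | nat : Ty
  | arr : Ty → Ty → Ty
  | seq : Ty → Ty

infixr:60 " ⇾ " => Ty.arr

/-- A family `V : Ty → Type` lists the variables of each type that may occur free.
`Ext σ V` is `V` together with one new variable (`zero`) of type `σ`. Bound variables are
nameless: the scope of a quantifier over `V` is a formula over `Ext σ V`. -/
inductive Ext (σ : Ty) (V : Ty → Type) : Ty → Type
  | zero : Ext σ V σ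
  | succ {τ : Ty} : V τ → Ext σ V τ

/-- The constants: zero, successor, the combinators `Π` and `Σ`, the recursors of Gödel's `T`,
the empty sequence, the prepending operation, and the list recursors. -/
inductive Con : Ty → Type
  | zero : Con Ty.nat
  | succ : Con (Ty.nat ⇾ Ty.nat)
  | pi (σ τ : Ty) : Con (σ ⇾ τ ⇾ σ)
  | sigma (ρ σ τ : Ty) : Con ((ρ ⇾ σ ⇾ τ) ⇾ (ρ ⇾ σ) ⇾ ρ ⇾ τ)
  | recN (ρ : Ty) : Con (Ty.nat ⇾ ρ ⇾ (ρ ⇾ Ty.nat ⇾ ρ) ⇾ ρ)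
  | nil (σ : Ty) : Con (Ty.seq σ)
  | cons (σ : Ty) : Con (σ ⇾ Ty.seq σ ⇾ Ty.seq σ)
  | recL (σ ρ : Ty) : Con (Ty.seq σ ⇾ ρ ⇾ (ρ ⇾ σ ⇾ Ty.seq σ ⇾ ρ) ⇾ ρ)

/-- Terms with free variables from `V`. -/
inductive Tm (V : Ty → Type) : Ty → Type
  | var {σ : Ty} : V σ → Tm V σ
  | con {σ : Ty} : Con σ → Tm V σ
  | app {σ τ : Ty} : Tm V (σ ⇾ τ) → Tm V σ → Tm V τ

/-- Simultaneous substitutions. -/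
def Sub (V W : Ty → Type) : Type := ∀ τ : Ty, V τ → Tm W τ

/-- The identity substitution. -/
def Sub.id (V : Ty → Type) : Sub V V := fun _ x => Tm.var x

/-- The substitution sending the newest variable to `t` and the others according to `f`. -/
def Sub.cons {V W : Ty → Type} {σ : Ty} (t : Tm W σ) (f : Sub V W) : Sub (Ext σ V) W
  | _, Ext.zero => t
  | _, Ext.succ x => f _ x

/-- Applying a substitution to a term. -/
def Tm.bind {V W : Ty → Type} (f : Sub V W) : {σ : Ty} → Tm V σ → Tm W σ
  | _, Tm.var x => f _ x
  | _, Tm.con c => Tm.con c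
  | _, Tm.app s t => Tm.app (s.bind f) (t.bind f)

/-- Weakenings by one, two and three new variables, as substitutions. -/
def Sub.wk1 {V : Ty → Type} {σ : Ty} : Sub V (Ext σ V) :=
  fun _ x => Tm.var (Ext.succ x)

def Sub.wk2 {V : Ty → Type} {σ τ : Ty} : Sub V (Ext τ (Ext σ V)) :=
  fun _ x => Tm.var (Ext.succ (Ext.succ x))

def Sub.wk3 {V : Ty → Type} {σ τ ρ : Ty} : Sub V (Ext ρ (Ext τ (Ext σ V))) :=
  fun _ x => Tm.var (Ext.succ (Ext.succ (Ext.succ x)))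

/-- Weakening of a term by one new variable. -/
def Tm.wk {V : Ty → Type} {σ τ : Ty} (t : Tm V τ) : Tm (Ext σ V) τ := t.bind Sub.wk1

/-- Passing a substitution under a binder. -/
def Sub.lift {V W : Ty → Type} {σ : Ty} (f : Sub V W) : Sub (Ext σ V) (Ext σ W) :=
  Sub.cons (Tm.var Ext.zero) (fun τ x => (f τ x).wk)

/-- The newest, second newest, third newest and fourth newest variable. -/
def Tm.v0 {V : Ty → Type} {σ : Ty} : Tm (Ext σ V) σ := Tm.var Ext.zero

def Tm.v1 {V : Ty → Type} {σ τ : Ty} : Tm (Ext τ (Ext σ V)) σ := Tm.var (Ext.succ Ext.zero)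

def Tm.v2 {V : Ty → Type} {σ τ ρ : Ty} : Tm (Ext ρ (Ext τ (Ext σ V))) σ :=
  Tm.var (Ext.succ (Ext.succ Ext.zero))

def Tm.v3 {V : Ty → Type} {σ τ ρ μ : Ty} : Tm (Ext μ (Ext ρ (Ext τ (Ext σ V)))) σ :=
  Tm.var (Ext.succ (Ext.succ (Ext.succ Ext.zero)))

/-- The formulas of the language with free variables from `V`. Only equality of natural numbers
is primitive; `st` is the standardness predicate, `allst` and `exst` are the external
quantifiers. -/
inductive Fml : (Ty → Type) → Type 1
  | eq {V : Ty → Type} : Tm V Ty.nat → Tm V Ty.nat → Fml V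
  | bot {V : Ty → Type} : Fml V
  | and {V : Ty → Type} : Fml V → Fml V → Fml V
  | or {V : Ty → Type} : Fml V → Fml V → Fml V
  | imp {V : Ty → Type} : Fml V → Fml V → Fml V
  | all {V : Ty → Type} (σ : Ty) : Fml (Ext σ V) → Fml V
  | ex {V : Ty → Type} (σ : Ty) : Fml (Ext σ V) → Fml V
  | st {V : Ty → Type} {σ : Ty} : Tm V σ → Fml V
  | allst {V : Ty → Type} (σ : Ty) : Fml (Ext σ V) → Fml V
  | exst {V : Ty → Type} (σ : Ty) : Fml (Ext σ V) → Fml V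

/-- Internal formulas: those without `st` and external quantifiers. -/
def Fml.Internal : {V : Ty → Type} → Fml V → Prop
  | _, .eq _ _ => True
  | _, .bot => True
  | _, .and φ ψ => φ.Internal ∧ ψ.Internal
  | _, .or φ ψ => φ.Internal ∧ ψ.Internal
  | _, .imp φ ψ => φ.Internal ∧ ψ.Internal
  | _, .all _ φ => φ.Internal
  | _, .ex _ φ => φ.Internal
  | _, .st _ => False
  | _, .allst _ _ => False
  | _, .exst _ _ => False

/-- Applying a substitution to a formula. -/
def Fml.bind : {V W : Ty → Type} → Sub V W → Fml V → Fml W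
  | _, _, f, .eq s t => .eq (s.bind f) (t.bind f)
  | _, _, _, .bot => .bot
  | _, _, f, .and φ ψ => .and (φ.bind f) (ψ.bind f)
  | _, _, f, .or φ ψ => .or (φ.bind f) (ψ.bind f)
  | _, _, f, .imp φ ψ => .imp (φ.bind f) (ψ.bind f)
  | _, _, f, .all σ φ => .all σ (φ.bind f.lift)
  | _, _, f, .ex σ φ => .ex σ (φ.bind f.lift)
  | _, _, f, .st t => .st (t.bind f)
  | _, _, f, .allst σ φ => .allst σ (φ.bind f.lift)
  | _, _, f, .exst σ φ => .exst σ (φ.bind f.lift)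

/-- Weakening of a formula by one new variable. -/
def Fml.wk {V : Ty → Type} {σ : Ty} (φ : Fml V) : Fml (Ext σ V) := φ.bind Sub.wk1

/-- Instantiation of the newest variable by a term. -/
def Fml.inst {V : Ty → Type} {σ : Ty} (φ : Fml (Ext σ V)) (t : Tm V σ) : Fml V :=
  φ.bind (Sub.cons t (Sub.id V))

def Fml.neg {V : Ty → Type} (φ : Fml V) : Fml V := φ.imp .bot

def Fml.iff {V : Ty → Type} (φ ψ : Fml V) : Fml V := (φ.imp ψ).and (ψ.imp φ)

/-! ## Defined terms and formulas -/

/-- Lambda abstraction, defined through the combinators. -/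
def Tm.lam {V : Ty → Type} {σ : Ty} : {τ : Ty} → Tm (Ext σ V) τ → Tm V (σ ⇾ τ)
  | _, .var Ext.zero =>
      .app (.app (.con (.sigma σ (σ ⇾ σ) σ)) (.con (.pi σ (σ ⇾ σ)))) (.con (.pi σ σ))
  | τ, .var (Ext.succ x) => .app (.con (.pi τ σ)) (.var x)
  | τ, .con c => .app (.con (.pi τ σ)) (.con c)
  | _, .app s t => .app (.app (.con (.sigma σ _ _)) s.lam) t.lam

def Tm.zero {V : Ty → Type} : Tm V Ty.nat := .con .zero

def Tm.succ {V : Ty → Type} (t : Tm V Ty.nat) : Tm V Ty.nat := .app (.con .succ) t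

def Tm.recN {V : Ty → Type} {ρ : Ty} (n : Tm V Ty.nat) (y : Tm V ρ)
    (z : Tm V (ρ ⇾ Ty.nat ⇾ ρ)) : Tm V ρ :=
  .app (.app (.app (.con (.recN ρ)) n) y) z

def Tm.nil {V : Ty → Type} (σ : Ty) : Tm V (Ty.seq σ) := .con (.nil σ)

def Tm.cons {V : Ty → Type} {σ : Ty} (a : Tm V σ) (s : Tm V (Ty.seq σ)) : Tm V (Ty.seq σ) :=
  .app (.app (.con (.cons σ)) a) s

def Tm.recL {V : Ty → Type} {σ ρ : Ty} (s : Tm V (Ty.seq σ)) (y : Tm V ρ)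
    (z : Tm V (ρ ⇾ σ ⇾ Ty.seq σ ⇾ ρ)) : Tm V ρ :=
  .app (.app (.app (.con (.recL σ ρ)) s) y) z

/-- A default closed term of each type. -/
def Tm.dflt {V : Ty → Type} : (σ : Ty) → Tm V σ
  | .nat => Tm.zero
  | .arr σ τ => .app (.con (.pi τ σ)) (Tm.dflt τ)
  | .seq σ => Tm.nil σ

/-- Addition, by recursion on the second argument. -/
def Tm.add {V : Ty → Type} (m n : Tm V Ty.nat) : Tm V Ty.nat :=
  Tm.recN n m (Tm.lam (Tm.lam (Tm.succ Tm.v1)))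

/-- The length `|s|` of a finite sequence. -/
def Tm.len {V : Ty → Type} {σ : Ty} (s : Tm V (Ty.seq σ)) : Tm V Ty.nat :=
  Tm.recL s Tm.zero (Tm.lam (Tm.lam (Tm.lam (Tm.succ Tm.v2))))

/-- The component of a finite sequence with a given index (and a default value beyond the
length). Under the four abstractions of the step term the variables are: the value of the
recursion on the tail, the head, the tail, the index. -/
def Tm.get {V : Ty → Type} {σ : Ty} (s : Tm V (Ty.seq σ)) (i : Tm V Ty.nat) : Tm V σ :=
  .app
    (Tm.recL s (Tm.lam (Tm.dflt σ))
      (Tm.lam (σ := Ty.nat ⇾ σ) (Tm.lam (σ := σ) (Tm.lam (σ := Ty.seq σ) (Tm.lam (σ := Ty.nat)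
        (Tm.recN Tm.v0 Tm.v2
          (Tm.lam (Tm.lam (Tm.app (Tm.wk (Tm.wk Tm.v3)) Tm.v0)))))))))
    i

/-- `m < n` on natural numbers. -/
def Fml.lt {V : Ty → Type} (m n : Tm V Ty.nat) : Fml V :=
  .ex .nat (.eq (Tm.add m.wk (Tm.succ Tm.v0)) n.wk)

/-- Equality at all types, defined extensionally. -/
def Fml.eqAt : {V : Ty → Type} → (σ : Ty) → Tm V σ → Tm V σ → Fml V
  | _, .nat, s, t => .eq s t
  | _, .arr σ τ, s, t => .all σ (Fml.eqAt τ (.app s.wk Tm.v0) (.app t.wk Tm.v0))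
  | _, .seq σ, s, t =>
      .and (.eq s.len t.len)
        (.all .nat (.imp (Fml.lt Tm.v0 s.wk.len)
          (Fml.eqAt σ (Tm.get s.wk Tm.v0) (Tm.get t.wk Tm.v0))))

/-- `x ∈ s`: `x` equals one of the components of `s`. -/
def Fml.mem {V : Ty → Type} {σ : Ty} (x : Tm V σ) (s : Tm V (Ty.seq σ)) : Fml V :=
  .ex .nat (.and (Fml.lt Tm.v0 s.wk.len) (Fml.eqAt σ x.wk (Tm.get s.wk Tm.v0)))

/-! ## Derivability -/

/-- An axiom system, given by its axioms in all variable contexts. -/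
def AxSys : Type 1 := ∀ V : Ty → Type, Set (Fml V)

/-- The axiom system obtained by putting two systems together. -/
def AxSys.union (T U : AxSys) : AxSys := fun V => T V ∪ U V

/-- Natural deduction for intuitionistic many-sorted predicate logic over the axioms `T`;
`Prf T Γ φ` says that `φ` is derivable from the assumptions `Γ`. -/
inductive Prf (T : AxSys) : {V : Ty → Type} → List (Fml V) → Fml V → Prop
  | ax {V : Ty → Type} {Γ : List (Fml V)} {φ : Fml V} : φ ∈ T V → Prf T Γ φ
  | hyp {V : Ty → Type} {Γ : List (Fml V)} {φ : Fml V} : φ ∈ Γ → Prf T Γ φ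
  | botE {V : Ty → Type} {Γ : List (Fml V)} {φ : Fml V} : Prf T Γ .bot → Prf T Γ φ
  | andI {V : Ty → Type} {Γ : List (Fml V)} {φ ψ : Fml V} :
      Prf T Γ φ → Prf T Γ ψ → Prf T Γ (.and φ ψ)
  | andE₁ {V : Ty → Type} {Γ : List (Fml V)} {φ ψ : Fml V} : Prf T Γ (.and φ ψ) → Prf T Γ φ
  | andE₂ {V : Ty → Type} {Γ : List (Fml V)} {φ ψ : Fml V} : Prf T Γ (.and φ ψ) → Prf T Γ ψ
  | orI₁ {V : Ty → Type} {Γ : List (Fml V)} {φ ψ : Fml V} : Prf T Γ φ → Prf T Γ (.or φ ψ)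
  | orI₂ {V : Ty → Type} {Γ : List (Fml V)} {φ ψ : Fml V} : Prf T Γ ψ → Prf T Γ (.or φ ψ)
  | orE {V : Ty → Type} {Γ : List (Fml V)} {φ ψ χ : Fml V} :
      Prf T Γ (.or φ ψ) → Prf T (φ :: Γ) χ → Prf T (ψ :: Γ) χ → Prf T Γ χ
  | impI {V : Ty → Type} {Γ : List (Fml V)} {φ ψ : Fml V} :
      Prf T (φ :: Γ) ψ → Prf T Γ (.imp φ ψ)
  | impE {V : Ty → Type} {Γ : List (Fml V)} {φ ψ : Fml V} :
      Prf T Γ (.imp φ ψ) → Prf T Γ φ → Prf T Γ ψ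
  | allI {V : Ty → Type} {Γ : List (Fml V)} {σ : Ty} {φ : Fml (Ext σ V)} :
      Prf T (Γ.map Fml.wk) φ → Prf T Γ (.all σ φ)
  | allE {V : Ty → Type} {Γ : List (Fml V)} {σ : Ty} {φ : Fml (Ext σ V)} (t : Tm V σ) :
      Prf T Γ (.all σ φ) → Prf T Γ (φ.inst t)
  | exI {V : Ty → Type} {Γ : List (Fml V)} {σ : Ty} {φ : Fml (Ext σ V)} (t : Tm V σ) :
      Prf T Γ (φ.inst t) → Prf T Γ (.ex σ φ)
  | exE {V : Ty → Type} {Γ : List (Fml V)} {σ : Ty} {φ : Fml (Ext σ V)} {ψ : Fml V} :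
      Prf T Γ (.ex σ φ) → Prf T (φ :: Γ.map Fml.wk) ψ.wk → Prf T Γ ψ

/-- The variables of the language: countably many of each type. -/
def Vars : Ty → Type := fun _ => ℕ

/-- `T ⊢ φ`, for a formula `φ` of the language. -/
def AxSys.Proves (T : AxSys) (φ : Fml Vars) : Prop := Prf T [] φ

/-! ## The axiom systems -/

/-- The nonlogical axioms of extensional Heyting arithmetic in all finite types. -/
inductive EHA : ∀ V : Ty → Type, Fml V → Prop
  | eqRefl {V : Ty → Type} (x : Tm V .nat) : EHA V (.eq x x)
  | eqSymm {V : Ty → Type} (x y : Tm V .nat) : EHA V (.imp (.eq x y) (.eq y x))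
  | eqTrans {V : Ty → Type} (x y z : Tm V .nat) :
      EHA V (.imp (.and (.eq x y) (.eq y z)) (.eq x z))
  /-- Extensionality. -/
  | ext {V : Ty → Type} {σ τ : Ty} (z : Tm V (σ ⇾ τ)) (x y : Tm V σ) :
      EHA V (.imp (.eqAt σ x y) (.eqAt τ (.app z x) (.app z y)))
  | succNeZero {V : Ty → Type} (x : Tm V .nat) : EHA V (Fml.neg (.eq x.succ Tm.zero))
  | succInj {V : Ty → Type} (x y : Tm V .nat) :
      EHA V (.imp (.eq x.succ y.succ) (.eq x y))
  /-- Internal induction. -/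
  | ind {V : Ty → Type} (φ : Fml (Ext .nat V)) (hφ : φ.Internal) :
      EHA V (.imp
        (.and (φ.inst Tm.zero)
          (.all .nat (.imp φ (φ.bind (Sub.cons (Tm.succ Tm.v0) Sub.wk1)))))
        (.all .nat φ))
  | pi {V : Ty → Type} {σ τ : Ty} (x : Tm V σ) (y : Tm V τ) :
      EHA V (.eqAt σ (.app (.app (.con (.pi σ τ)) x) y) x)
  | sigma {V : Ty → Type} {ρ σ τ : Ty} (x : Tm V (ρ ⇾ σ ⇾ τ)) (y : Tm V (ρ ⇾ σ)) (z : Tm V ρ) :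
      EHA V (.eqAt τ (.app (.app (.app (.con (.sigma ρ σ τ)) x) y) z)
        (.app (.app x z) (.app y z)))
  | recZero {V : Ty → Type} {ρ : Ty} (y : Tm V ρ) (z : Tm V (ρ ⇾ .nat ⇾ ρ)) :
      EHA V (.eqAt ρ (Tm.recN Tm.zero y z) y)
  | recSucc {V : Ty → Type} {ρ : Ty} (n : Tm V .nat) (y : Tm V ρ) (z : Tm V (ρ ⇾ .nat ⇾ ρ)) :
      EHA V (.eqAt ρ (Tm.recN n.succ y z) (.app (.app z (Tm.recN n y z)) n))
  | recNil {V : Ty → Type} {σ ρ : Ty} (y : Tm V ρ) (z : Tm V (ρ ⇾ σ ⇾ .seq σ ⇾ ρ)) :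
      EHA V (.eqAt ρ (Tm.recL (Tm.nil σ) y z) y)
  | recCons {V : Ty → Type} {σ ρ : Ty} (a : Tm V σ) (s : Tm V (.seq σ)) (y : Tm V ρ)
      (z : Tm V (ρ ⇾ σ ⇾ .seq σ ⇾ ρ)) :
      EHA V (.eqAt ρ (Tm.recL (Tm.cons a s) y z) (.app (.app (.app z (Tm.recL s y z)) a) s))
  /-- Every finite sequence is empty or results from prepending an object to a sequence. -/
  | seqCases {V : Ty → Type} {σ : Ty} (s : Tm V (.seq σ)) :
      EHA V (.or (.eqAt (.seq σ) s (Tm.nil σ))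
        (.ex σ (.ex (.seq σ) (.eqAt (.seq σ) s.wk.wk (Tm.cons Tm.v1 Tm.v0)))))

/-- A closed term, viewed as a term over `V`. -/
def Tm.ofClosed {V : Ty → Type} {σ : Ty} (t : Tm (fun _ => Empty) σ) : Tm V σ :=
  t.bind (fun _ x => x.elim)

/-- The axioms added for standardness: the defining axioms of the external quantifiers, the
axioms for `st`, and external induction. -/
inductive StAx : ∀ V : Ty → Type, Fml V → Prop
  | allst {V : Ty → Type} {σ : Ty} (Φ : Fml (Ext σ V)) :
      StAx V (Fml.iff (.allst σ Φ) (.all σ (.imp (.st Tm.v0) Φ)))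
  | exst {V : Ty → Type} {σ : Ty} (Φ : Fml (Ext σ V)) :
      StAx V (Fml.iff (.exst σ Φ) (.ex σ (.and (.st Tm.v0) Φ)))
  | stEq {V : Ty → Type} {σ : Ty} (x y : Tm V σ) :
      StAx V (.imp (.and (.st x) (.eqAt σ x y)) (.st y))
  | stClosed {V : Ty → Type} {σ : Ty} (t : Tm (fun _ => Empty) σ) : StAx V (.st t.ofClosed)
  | stApp {V : Ty → Type} {σ τ : Ty} (f : Tm V (σ ⇾ τ)) (x : Tm V σ) :
      StAx V (.imp (.and (.st f) (.st x)) (.st (.app f x)))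
  | indSt {V : Ty → Type} (Φ : Fml (Ext .nat V)) :
      StAx V (.imp
        (.and (Φ.inst Tm.zero)
          (.allst .nat (.imp Φ (Φ.bind (Sub.cons (Tm.succ Tm.v0) Sub.wk1)))))
        (.allst .nat Φ))

/-- The law of excluded middle, for all formulas of the language. -/
inductive LEM : ∀ V : Ty → Type, Fml V → Prop
  | lem {V : Ty → Type} (Φ : Fml V) : LEM V (.or Φ Φ.neg)

/-- Intuitionistic and classical arithmetic in all finite types with standardness. -/
def EHAst : AxSys := fun V => {φ | EHA V φ ∨ StAx V φ}

def EPAst : AxSys := fun V => {φ | φ ∈ EHAst V ∨ LEM V φ}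

/-- The instance of idealisation for `φ(x, y)`, where `y` is the newest variable of `φ` and `x`
the second newest:
`∀st x' ∃ y ∀ x ∈ x', φ(x, y) → ∃ y ∀st x, φ(x, y)`. -/
def idealisation {V : Ty → Type} {σ τ : Ty} (φ : Fml (Ext τ (Ext σ V))) : Fml V :=
  .imp
    (.allst (.seq σ) (.ex τ (.all σ
      (.imp (.mem Tm.v0 Tm.v2) (φ.bind (Sub.cons Tm.v1 (Sub.cons Tm.v0 Sub.wk3)))))))
    (.ex τ (.allst σ (φ.bind (Sub.cons Tm.v1 (Sub.cons Tm.v0 Sub.wk2)))))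

/-- The instance of herbrandised choice for `φ(x, y)`, variables as before:
`∀st x ∃st y, φ(x, y) → ∃st F ∀st x ∃ y ∈ F(x), φ(x, y)`. -/
def herbrandChoice {V : Ty → Type} {σ τ : Ty} (φ : Fml (Ext τ (Ext σ V))) : Fml V :=
  .imp
    (.allst σ (.exst τ φ))
    (.exst (σ ⇾ .seq τ) (.allst σ (.ex τ
      (.and (.mem Tm.v0 (.app Tm.v2 Tm.v1))
        (φ.bind (Sub.cons Tm.v0 (Sub.cons Tm.v1 Sub.wk3)))))))

/-- The schemas `I` and `HAC_int`, for internal formulas. -/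
inductive IdealHAC : ∀ V : Ty → Type, Fml V → Prop
  | ideal {V : Ty → Type} {σ τ : Ty} (φ : Fml (Ext τ (Ext σ V))) (hφ : φ.Internal) :
      IdealHAC V (idealisation φ)
  | hac {V : Ty → Type} {σ τ : Ty} (φ : Fml (Ext τ (Ext σ V))) (hφ : φ.Internal) :
      IdealHAC V (herbrandChoice φ)

/-- The classical nonstandard system `P`. -/
def P : AxSys := fun V => {φ | φ ∈ EPAst V ∨ IdealHAC V φ}

/-- The instance of countable standard choice for `Φ(n, x)`, where `x` is the newest variable of
`Φ` and `n` the second newest: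
`∀st n ∃st x, Φ(n, x) → ∃st f ∀st n, Φ(n, f(n))`. -/
def choiceSt {V : Ty → Type} {σ : Ty} (Φ : Fml (Ext σ (Ext .nat V))) : Fml V :=
  .imp
    (.allst .nat (.exst σ Φ))
    (.exst (.nat ⇾ σ) (.allst .nat
      (Φ.bind (Sub.cons (.app Tm.v1 Tm.v0) (Sub.cons Tm.v0 Sub.wk2)))))

/-- The instance of countable saturation for `Φ(n, x)`, variables as before:
`∀st n ∃ x, Φ(n, x) → ∃ f ∀st n, Φ(n, f(n))`. -/
def csat {V : Ty → Type} {σ : Ty} (Φ : Fml (Ext σ (Ext .nat V))) : Fml V :=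
  .imp
    (.allst .nat (.ex σ Φ))
    (.ex (.nat ⇾ σ) (.allst .nat
      (Φ.bind (Sub.cons (.app Tm.v1 Tm.v0) (Sub.cons Tm.v0 Sub.wk2)))))

/-- The schema `AC_0^st`: all instances of countable standard choice, at all types and for all
formulas, external ones included. -/
def AC0st : AxSys := fun V =>
  {A | ∃ (σ : Ty) (Φ : Fml (Ext σ (Ext .nat V))), A = choiceSt Φ}

/-- The schema `CSAT`: all instances of countable saturation. -/
def CSAT : AxSys := fun V =>
  {A | ∃ (σ : Ty) (Φ : Fml (Ext σ (Ext .nat V))), A = csat Φ}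

end NSArith

/-! The derivation is obtained semantically. A Henkin construction (`exists_isTruth`) turns the
underivability of a formula into a complete consistent set with witnesses that omits it. Terms
modulo the equality true in this set form a model in which extensional equality is identity
(`IsTruth.good_model`). By `proves_of_forall_model` it then suffices to argue inside such models.

In a model every formula is equivalent to some ∀st u ∃st v φ with φ internal (`Model.Good.nf`).
Herbrandised choice rewrites this as ∃st F ∀st u ∃ v ∈ F(u) φ, whose negation again has the required
shape. The dual of idealisation absorbs an unrestricted ∀ by collecting candidates for v in one
standard finite sequence. Definable pairs merge the quantifiers of a disjunction. Bounding v by a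
standard sequence is harmless, because components of standard sequences are standard
(`Model.Good.st_of_mem`).

Now let ∀st n ∃ x ∀st u ∃st v φ(n, x, u, v). Standard choice cannot select x, which need not be
standard. But for each standard n, `HAC_int` gives a standard F with ∃ x ∀st u ∃ v ∈ F(u) φ. This is
an external condition on n and F, and `AC0st` applied to it gives a standard G with G(n) as such an
F. With G as parameter, ∃ v ∈ G(n)(u) φ is internal, so ∀st u is the only external part left.
Conditions of that form are saturated by idealisation (`Model.Good.saturation`): for a standard
finite sequence of pairs (n, u) a suitable f is built by changing a function at one argument at a
time, and idealisation makes one f serve all standard n and u. -/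

namespace NSArith

/-! ## Substitution -/

/-- Composition of substitutions. -/
def Sub.comp {U V W : Ty → Type} (f : Sub U V) (g : Sub V W) : Sub U W :=
  fun τ x => (f τ x).bind g

theorem Tm.bind_bind {U V W : Ty → Type} (f : Sub U V) (g : Sub V W) {σ : Ty} (t : Tm U σ) :
    (t.bind f).bind g = t.bind (f.comp g) := by
  induction t with
  | var x => rfl
  | con c => rfl
  | app s t ihs iht => simp [Tm.bind, ihs, iht]

theorem Tm.bind_id {V : Ty → Type} {σ : Ty} (t : Tm V σ) : t.bind (Sub.id V) = t := by
  induction t with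
  | var x => rfl
  | con c => rfl
  | app s t ihs iht => simp [Tm.bind, ihs, iht]

theorem Tm.wk_bind_cons {V W : Ty → Type} {σ τ : Ty} (a : Tm W σ) (f : Sub V W) (t : Tm V τ) :
    (t.wk (σ := σ)).bind (Sub.cons a f) = t.bind f := by
  unfold Tm.wk
  rw [Tm.bind_bind]
  rfl

theorem Tm.wk_bind_lift {V W : Ty → Type} {σ τ : Ty} (f : Sub V W) (t : Tm V τ) :
    (t.wk (σ := σ)).bind f.lift = (t.bind f).wk := by
  refine (Tm.wk_bind_cons (Tm.var Ext.zero) (fun τ x => (f τ x).wk) t).trans ?_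
  exact (Tm.bind_bind f Sub.wk1 t).symm

theorem Tm.v0_bind_cons {V W : Ty → Type} {σ : Ty} (a : Tm W σ) (f : Sub V W) :
    (Tm.v0 (V := V)).bind (Sub.cons a f) = a := rfl

theorem Tm.v0_bind_lift {V W : Ty → Type} {σ : Ty} (f : Sub V W) :
    (Tm.v0 (V := V) (σ := σ)).bind f.lift = Tm.v0 := rfl

theorem Sub.ext_cons {V W : Ty → Type} {σ : Ty} {f g : Sub (Ext σ V) W}
    (h0 : f _ Ext.zero = g _ Ext.zero) (hs : ∀ τ x, f τ (Ext.succ x) = g τ (Ext.succ x)) :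
    f = g := by
  funext τ x
  cases x with
  | zero => exact h0
  | succ x => exact hs _ x

theorem Sub.lift_comp_lift {U V W : Ty → Type} {σ : Ty} (f : Sub U V) (g : Sub V W) :
    (f.lift (σ := σ)).comp g.lift = (f.comp g).lift :=
  Sub.ext_cons rfl fun _ x => Tm.wk_bind_lift g (f _ x)

theorem Sub.lift_id {V : Ty → Type} {σ : Ty} : (Sub.id V).lift (σ := σ) = Sub.id _ :=
  Sub.ext_cons rfl fun _ _ => rfl

theorem Sub.comp_id {V W : Ty → Type} (f : Sub V W) : f.comp (Sub.id W) = f := by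
  funext τ x
  exact Tm.bind_id _

theorem Sub.id_comp {V W : Ty → Type} (f : Sub V W) : (Sub.id V).comp f = f := rfl

theorem Sub.cons_comp {U V W : Ty → Type} {σ : Ty} (a : Tm V σ) (f : Sub U V) (g : Sub V W) :
    (Sub.cons a f).comp g = Sub.cons (a.bind g) (f.comp g) :=
  Sub.ext_cons rfl fun _ _ => rfl

theorem Sub.lift_comp_cons {U V W : Ty → Type} {σ : Ty} (f : Sub U V) (a : Tm W σ)
    (g : Sub V W) : (f.lift (σ := σ)).comp (Sub.cons a g) = Sub.cons a (f.comp g) :=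
  Sub.ext_cons rfl fun _ x => Tm.wk_bind_cons a g (f _ x)

theorem Sub.wk1_comp_lift {V W : Ty → Type} {σ : Ty} (g : Sub V W) :
    (Sub.wk1 (V := V) (σ := σ)).comp g.lift = g.comp Sub.wk1 := rfl

theorem Sub.wk2_comp_lift {V W : Ty → Type} {σ τ : Ty} (g : Sub V W) :
    (Sub.wk2 (V := V) (σ := σ) (τ := τ)).comp g.lift.lift = g.comp Sub.wk2 := by
  funext ρ x
  change ((g ρ x).wk).wk = _
  unfold Tm.wk
  rw [Tm.bind_bind]
  rfl

theorem Sub.wk3_comp_lift {V W : Ty → Type} {σ τ μ : Ty} (g : Sub V W) :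
    (Sub.wk3 (V := V) (σ := σ) (τ := τ) (ρ := μ)).comp g.lift.lift.lift = g.comp Sub.wk3 := by
  funext ρ x
  change ((g ρ x).wk).wk.wk = _
  unfold Tm.wk
  rw [Tm.bind_bind, Tm.bind_bind]
  rfl

theorem Fml.bind_bind {U V W : Ty → Type} (f : Sub U V) (g : Sub V W) (φ : Fml U) :
    (φ.bind f).bind g = φ.bind (f.comp g) := by
  induction φ generalizing V W with
  | eq s t => simp [Fml.bind, Tm.bind_bind]
  | bot => rfl
  | and φ ψ ih₁ ih₂ => simp [Fml.bind, ih₁, ih₂]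
  | or φ ψ ih₁ ih₂ => simp [Fml.bind, ih₁, ih₂]
  | imp φ ψ ih₁ ih₂ => simp [Fml.bind, ih₁, ih₂]
  | all σ φ ih => simp [Fml.bind, ih, Sub.lift_comp_lift]
  | ex σ φ ih => simp [Fml.bind, ih, Sub.lift_comp_lift]
  | st t => simp [Fml.bind, Tm.bind_bind]
  | allst σ φ ih => simp [Fml.bind, ih, Sub.lift_comp_lift]
  | exst σ φ ih => simp [Fml.bind, ih, Sub.lift_comp_lift]

theorem Fml.bind_id {V : Ty → Type} (φ : Fml V) : φ.bind (Sub.id V) = φ := by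
  induction φ with
  | eq s t => simp [Fml.bind, Tm.bind_id]
  | bot => rfl
  | and φ ψ ih₁ ih₂ => simp [Fml.bind, ih₁, ih₂]
  | or φ ψ ih₁ ih₂ => simp [Fml.bind, ih₁, ih₂]
  | imp φ ψ ih₁ ih₂ => simp [Fml.bind, ih₁, ih₂]
  | all σ φ ih => simp [Fml.bind, ih, Sub.lift_id]
  | ex σ φ ih => simp [Fml.bind, ih, Sub.lift_id]
  | st t => simp [Fml.bind, Tm.bind_id]
  | allst σ φ ih => simp [Fml.bind, ih, Sub.lift_id]
  | exst σ φ ih => simp [Fml.bind, ih, Sub.lift_id]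

theorem Fml.Internal.bind {V W : Ty → Type} {φ : Fml V} (h : φ.Internal) (f : Sub V W) :
    (φ.bind f).Internal := by
  induction φ generalizing W with
  | eq s t => trivial
  | bot => trivial
  | and φ ψ ih₁ ih₂ => exact ⟨ih₁ h.1 f, ih₂ h.2 f⟩
  | or φ ψ ih₁ ih₂ => exact ⟨ih₁ h.1 f, ih₂ h.2 f⟩
  | imp φ ψ ih₁ ih₂ => exact ⟨ih₁ h.1 f, ih₂ h.2 f⟩
  | all σ φ ih => exact ih h f.lift
  | ex σ φ ih => exact ih h f.lift
  | st t => exact h.elim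
  | allst σ φ ih => exact h.elim
  | exst σ φ ih => exact h.elim

theorem Fml.wk_bind_lift {V W : Ty → Type} {σ : Ty} (f : Sub V W) (φ : Fml V) :
    (φ.wk (σ := σ)).bind f.lift = (φ.bind f).wk := by
  simp only [Fml.wk, Fml.bind_bind, Sub.wk1_comp_lift]

theorem Fml.inst_bind {V W : Ty → Type} {σ : Ty} (f : Sub V W) (φ : Fml (Ext σ V)) (t : Tm V σ) :
    (φ.inst t).bind f = (φ.bind f.lift).inst (t.bind f) := by
  simp only [Fml.inst, Fml.bind_bind, Sub.cons_comp, Sub.lift_comp_cons, Sub.comp_id, Sub.id_comp]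

theorem Fml.bind_lift_inst {V W : Ty → Type} {σ : Ty} (f : Sub V W) (φ : Fml (Ext σ V))
    (t : Tm W σ) : (φ.bind f.lift).inst t = φ.bind (Sub.cons t f) := by
  simp only [Fml.inst, Fml.bind_bind, Sub.lift_comp_cons, Sub.comp_id]

theorem Fml.bind_lift_wk_inst {V : Ty → Type} {σ : Ty} (φ : Fml (Ext σ V)) :
    (φ.bind (Sub.wk1 (σ := σ)).lift).inst Tm.v0 = φ := by
  rw [Fml.bind_lift_inst]
  conv_rhs => rw [← Fml.bind_id φ]
  congr 1
  exact Sub.ext_cons rfl fun _ _ => rfl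

/-! ### Substitution in the defined terms and formulas -/

section
variable {V W : Ty → Type} (f : Sub V W)

theorem Tm.succ_bind (t : Tm V .nat) : t.succ.bind f = (t.bind f).succ := rfl

theorem Tm.dflt_bind (σ : Ty) : (Tm.dflt (V := V) σ).bind f = Tm.dflt σ := by
  induction σ with
  | nat => rfl
  | arr σ τ _ ih => simp [Tm.dflt, Tm.bind, ih]
  | seq σ _ => rfl

/-- Abstraction is defined by inspecting the term, and the default term depends on the type σ, so
nothing reduces until σ is analysed. This is the one part of `Tm.get` whose substitution is not
computed by `rfl`. -/
theorem Tm.lam_dflt_bind (ρ σ : Ty) :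
    (Tm.lam (σ := ρ) (Tm.dflt (V := Ext ρ V) σ)).bind f = Tm.lam (Tm.dflt σ) := by
  induction σ with
  | nat => rfl
  | arr σ τ _ ih => simp [Tm.dflt, Tm.lam, Tm.bind, ih]
  | seq σ _ => rfl

theorem Tm.add_bind (m n : Tm V .nat) : (Tm.add m n).bind f = Tm.add (m.bind f) (n.bind f) := rfl

theorem Tm.len_bind {σ : Ty} (s : Tm V (.seq σ)) : s.len.bind f = (s.bind f).len := rfl

theorem Tm.get_bind {σ : Ty} (s : Tm V (.seq σ)) (i : Tm V .nat) :
    (Tm.get s i).bind f = Tm.get (s.bind f) (i.bind f) := by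
  unfold Tm.get Tm.recL
  simp only [Tm.bind, Tm.lam_dflt_bind]
  rfl

theorem Fml.lt_bind (m n : Tm V .nat) : (Fml.lt m n).bind f = Fml.lt (m.bind f) (n.bind f) := by
  simp only [Fml.lt, Fml.bind, Tm.add_bind, Tm.succ_bind, Tm.wk_bind_lift, Tm.v0_bind_lift]

theorem Fml.eqAt_bind (σ : Ty) {V W : Ty → Type} (f : Sub V W) (s t : Tm V σ) :
    (Fml.eqAt σ s t).bind f = Fml.eqAt σ (s.bind f) (t.bind f) := by
  induction σ generalizing V W with
  | nat => rfl
  | arr σ τ _ ih =>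
    simp only [Fml.eqAt, Fml.bind, ih, Tm.bind, Tm.wk_bind_lift, Tm.v0_bind_lift]
  | seq σ ih =>
    simp only [Fml.eqAt, Fml.bind, ih, Tm.wk_bind_lift, Tm.v0_bind_lift, Fml.lt_bind,
      Tm.len_bind, Tm.get_bind]

theorem Fml.mem_bind {σ : Ty} (x : Tm V σ) (s : Tm V (.seq σ)) :
    (Fml.mem x s).bind f = Fml.mem (x.bind f) (s.bind f) := by
  simp only [Fml.mem, Fml.bind, Fml.eqAt_bind, Tm.wk_bind_lift, Tm.v0_bind_lift, Fml.lt_bind,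
    Tm.len_bind, Tm.get_bind]

theorem Fml.idealisation_bind {σ τ : Ty} (φ : Fml (Ext τ (Ext σ V))) :
    (idealisation φ).bind f = idealisation (φ.bind f.lift.lift) := by
  simp only [idealisation, Fml.bind, Fml.mem_bind, Fml.bind_bind, Sub.cons_comp,
    Sub.lift_comp_cons, Sub.wk2_comp_lift, Sub.wk3_comp_lift]
  rfl

theorem Fml.herbrandChoice_bind {σ τ : Ty} (φ : Fml (Ext τ (Ext σ V))) :
    (herbrandChoice φ).bind f = herbrandChoice (φ.bind f.lift.lift) := by
  simp only [herbrandChoice, Fml.bind, Fml.mem_bind, Fml.bind_bind, Sub.cons_comp,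
    Sub.lift_comp_cons, Sub.wk3_comp_lift]
  rfl

theorem Fml.choiceSt_bind {σ : Ty} (Φ : Fml (Ext σ (Ext .nat V))) :
    (choiceSt Φ).bind f = choiceSt (Φ.bind f.lift.lift) := by
  simp only [choiceSt, Fml.bind, Fml.bind_bind, Sub.cons_comp,
    Sub.lift_comp_cons, Sub.wk2_comp_lift]
  rfl

theorem Fml.succ_bind (φ : Fml (Ext .nat V)) :
    (φ.bind (Sub.cons (Tm.succ Tm.v0) Sub.wk1)).bind f.lift =
      (φ.bind f.lift).bind (Sub.cons (Tm.succ Tm.v0) Sub.wk1) := by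
  simp only [Fml.bind_bind, Sub.cons_comp, Sub.lift_comp_cons, Sub.wk1_comp_lift]
  rfl

theorem Tm.ofClosed_bind {σ : Ty} (t : Tm (fun _ => Empty) σ) :
    (t.ofClosed (V := V)).bind f = t.ofClosed := by
  refine (Tm.bind_bind _ f t).trans (congrArg (fun g => Tm.bind g t) ?_)
  funext τ x
  exact x.elim

end

/-! ### Axiom systems closed under substitution -/

/-- An axiom system is closed under substitution. -/
def AxSys.Closed (T : AxSys) : Prop :=
  ∀ (V W : Ty → Type) (f : Sub V W), ∀ φ ∈ T V, φ.bind f ∈ T W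

theorem EHA.bind {V W : Ty → Type} (f : Sub V W) {φ : Fml V} (h : EHA V φ) :
    EHA W (φ.bind f) := by
  cases h with
  | eqRefl x => exact .eqRefl _
  | eqSymm x y => exact .eqSymm _ _
  | eqTrans x y z => exact .eqTrans _ _ _
  | ext z x y =>
    simp only [Fml.bind, Fml.eqAt_bind]
    exact .ext _ _ _
  | succNeZero x => exact .succNeZero _
  | succInj x y => exact .succInj _ _
  | ind φ hφ =>
    simp only [Fml.bind, Fml.inst_bind, Fml.succ_bind]
    exact .ind _ (hφ.bind _)
  | pi x y => rw [Fml.eqAt_bind]; exact .pi _ _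
  | sigma x y z => rw [Fml.eqAt_bind]; exact .sigma _ _ _
  | recZero y z => rw [Fml.eqAt_bind]; exact .recZero _ _
  | recSucc n y z => rw [Fml.eqAt_bind]; exact .recSucc _ _ _
  | recNil y z => rw [Fml.eqAt_bind]; exact .recNil _ _
  | recCons a s y z => rw [Fml.eqAt_bind]; exact .recCons _ _ _ _
  | seqCases s =>
    simp only [Fml.bind, Fml.eqAt_bind, Tm.wk_bind_lift]
    exact .seqCases _

theorem StAx.bind {V W : Ty → Type} (f : Sub V W) {φ : Fml V} (h : StAx V φ) :
    StAx W (φ.bind f) := by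
  cases h with
  | allst Φ => exact .allst _
  | exst Φ => exact .exst _
  | stEq x y =>
    simp only [Fml.bind, Fml.eqAt_bind]
    exact .stEq _ _
  | stClosed t =>
    simp only [Fml.bind, Tm.ofClosed_bind]
    exact .stClosed _
  | stApp g x => exact .stApp _ _
  | indSt Φ =>
    simp only [Fml.bind, Fml.inst_bind, Fml.succ_bind]
    exact .indSt _

/-- Closure is what allows derivations to be substituted into, hence variables to be renamed, and
the axioms to hold in the term model under every assignment. -/
theorem closed_P_union_AC0st : (P.union AC0st).Closed := by
  rintro V W f φ (((((h | h) | ⟨⟨Φ⟩⟩) | h) | ⟨σ, Φ, rfl⟩))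
  · exact .inl (.inl (.inl (.inl (h.bind f))))
  · exact .inl (.inl (.inl (.inr (h.bind f))))
  · exact .inl (.inl (.inr (.lem _)))
  · cases h with
    | ideal φ hφ =>
      rw [Fml.idealisation_bind]
      exact .inl (.inr (.ideal _ ((hφ.bind _))))
    | hac φ hφ =>
      rw [Fml.herbrandChoice_bind]
      exact .inl (.inr (.hac _ ((hφ.bind _))))
  · exact .inr ⟨σ, _, Fml.choiceSt_bind f Φ⟩

/-! ### Admissible rules -/

theorem Prf.weaken {T : AxSys} {V : Ty → Type} {Γ Δ : List (Fml V)} {φ : Fml V}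
    (h : Prf T Γ φ) (hΔ : Γ ⊆ Δ) : Prf T Δ φ := by
  induction h with
  | ax h => exact .ax h
  | hyp h => exact .hyp (hΔ h)
  | botE _ ih => exact .botE (ih hΔ)
  | andI _ _ ih₁ ih₂ => exact .andI (ih₁ hΔ) (ih₂ hΔ)
  | andE₁ _ ih => exact .andE₁ (ih hΔ)
  | andE₂ _ ih => exact .andE₂ (ih hΔ)
  | orI₁ _ ih => exact .orI₁ (ih hΔ)
  | orI₂ _ ih => exact .orI₂ (ih hΔ)
  | orE _ _ _ ih ih₁ ih₂ =>
    exact .orE (ih hΔ) (ih₁ (List.cons_subset_cons _ hΔ)) (ih₂ (List.cons_subset_cons _ hΔ))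
  | impI _ ih => exact .impI (ih (List.cons_subset_cons _ hΔ))
  | impE _ _ ih₁ ih₂ => exact .impE (ih₁ hΔ) (ih₂ hΔ)
  | allI _ ih => exact .allI (ih (List.map_subset _ hΔ))
  | allE t _ ih => exact .allE t (ih hΔ)
  | exI t _ ih => exact .exI t (ih hΔ)
  | exE _ _ ih₁ ih₂ =>
    exact .exE (ih₁ hΔ) (ih₂ (List.cons_subset_cons _ (List.map_subset _ hΔ)))

theorem Fml.map_wk_bind_lift {V W : Ty → Type} {σ : Ty} (f : Sub V W) (Γ : List (Fml V)) :
    (Γ.map (Fml.wk (σ := σ))).map (Fml.bind f.lift) = (Γ.map (Fml.bind f)).map Fml.wk := by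
  simp only [List.map_map]
  exact List.map_congr_left fun φ _ => Fml.wk_bind_lift f φ

theorem Prf.bind {T : AxSys} (hT : T.Closed) {V W : Ty → Type} (f : Sub V W) {Γ : List (Fml V)}
    {φ : Fml V} (h : Prf T Γ φ) : Prf T (Γ.map (Fml.bind f)) (φ.bind f) := by
  induction h generalizing W with
  | ax h => exact .ax (hT _ _ f _ h)
  | hyp h => exact .hyp (List.mem_map_of_mem h)
  | botE _ ih => exact .botE (ih f)
  | andI _ _ ih₁ ih₂ => exact .andI (ih₁ f) (ih₂ f)
  | andE₁ _ ih => exact .andE₁ (ih f)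
  | andE₂ _ ih => exact .andE₂ (ih f)
  | orI₁ _ ih => exact .orI₁ (ih f)
  | orI₂ _ ih => exact .orI₂ (ih f)
  | orE _ _ _ ih ih₁ ih₂ => exact .orE (ih f) (ih₁ f) (ih₂ f)
  | impI _ ih => exact .impI (ih f)
  | impE _ _ ih₁ ih₂ => exact .impE (ih₁ f) (ih₂ f)
  | allI _ ih =>
    have := ih f.lift
    rw [Fml.map_wk_bind_lift] at this
    exact .allI this
  | allE t _ ih =>
    rw [Fml.inst_bind]
    exact .allE _ (ih f)
  | exI t _ ih =>
    have := ih f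
    rw [Fml.inst_bind] at this
    exact .exI _ this
  | exE _ _ ih₁ ih₂ =>
    have := ih₂ f.lift
    rw [List.map_cons, Fml.map_wk_bind_lift, Fml.wk_bind_lift] at this
    exact .exE (ih₁ f) this

/-! ## Countability of the language -/

/-- Binary trees labelled by natural numbers, used as codes. -/
inductive Code : Type
  | leaf : ℕ → Code
  | node : ℕ → Code → Code → Code
  deriving Countable

def Ty.code : Ty → Code
  | .nat => .leaf 0
  | .arr σ τ => .node 0 σ.code τ.code
  | .seq σ => .node 1 σ.code σ.code

theorem Ty.code_injective : Function.Injective Ty.code := by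
  intro σ
  induction σ with
  | nat => intro τ h; cases τ <;> simp_all [Ty.code]
  | arr σ₁ σ₂ ih₁ ih₂ =>
    intro τ h
    cases τ <;> simp [Ty.code] at h
    rw [ih₁ h.1, ih₂ h.2]
  | seq σ ih =>
    intro τ h
    cases τ <;> simp [Ty.code] at h
    rw [ih h]

def Con.code : {σ : Ty} → Con σ → Code
  | _, .zero => .leaf 0
  | _, .succ => .leaf 1
  | _, .pi σ τ => .node 0 σ.code τ.code
  | _, .sigma ρ σ τ => .node 1 ρ.code (.node 0 σ.code τ.code)
  | _, .recN ρ => .node 2 ρ.code ρ.code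
  | _, .nil σ => .node 3 σ.code σ.code
  | _, .cons σ => .node 4 σ.code σ.code
  | _, .recL σ ρ => .node 5 σ.code ρ.code

/-- Types are allowed to differ, since a code must also determine the type of the constant. -/
theorem Con.code_injective {σ τ : Ty} (c : Con σ) (d : Con τ) (h : c.code = d.code) :
    σ = τ ∧ HEq c d := by
  cases c <;> cases d <;> simp [Con.code, Ty.code_injective.eq_iff] at h ⊢ <;>
    (obtain ⟨rfl, rfl, rfl⟩ := h; simp)

/-- The argument type is recorded at an application because the type of the result does not
determine it. -/
def Tm.code {V : Ty → Type} (e : ∀ τ, V τ → ℕ) : {σ : Ty} → Tm V σ → Code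
  | σ, .var x => .node 0 σ.code (.leaf (e _ x))
  | _, .con c => .node 1 c.code c.code
  | _, .app (σ := σ) s t => .node 2 σ.code (.node 0 (s.code e) (t.code e))

theorem Tm.code_injective {V : Ty → Type} (e : ∀ τ, V τ → ℕ)
    (he : ∀ τ, Function.Injective (e τ)) {σ : Ty} (s t : Tm V σ) (h : s.code e = t.code e) :
    s = t := by
  induction s with
  | var x =>
    cases t <;> simp [Tm.code] at h
    rw [he _ h]
  | con c =>
    cases t <;> simp [Tm.code] at h
    rw [eq_of_heq (Con.code_injective _ _ h).2]
  | app s₁ s₂ ih₁ ih₂ =>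
    cases t <;> simp [Tm.code, Ty.code_injective.eq_iff] at h
    obtain ⟨rfl, h₁, h₂⟩ := h
    rw [ih₁ _ h₁, ih₂ _ h₂]

/-- Extending a numbering of the variables by a new variable. -/
def Ext.number {σ : Ty} {V : Ty → Type} (e : ∀ τ, V τ → ℕ) : ∀ τ, Ext σ V τ → ℕ
  | _, .zero => 0
  | _, .succ x => e _ x + 1

theorem Ext.number_injective {σ : Ty} {V : Ty → Type} {e : ∀ τ, V τ → ℕ}
    (he : ∀ τ, Function.Injective (e τ)) (τ : Ty) :
    Function.Injective (Ext.number (σ := σ) e τ) := by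
  intro x y h
  cases x <;> cases y <;> simp [Ext.number] at h ⊢
  exact he _ h

def Fml.code : {V : Ty → Type} → (∀ τ, V τ → ℕ) → Fml V → Code
  | _, e, .eq s t => .node 0 (s.code e) (t.code e)
  | _, _, .bot => .leaf 0
  | _, e, .and φ ψ => .node 1 (φ.code e) (ψ.code e)
  | _, e, .or φ ψ => .node 2 (φ.code e) (ψ.code e)
  | _, e, .imp φ ψ => .node 3 (φ.code e) (ψ.code e)
  | _, e, .all σ φ => .node 4 σ.code (φ.code (Ext.number e))
  | _, e, .ex σ φ => .node 5 σ.code (φ.code (Ext.number e))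
  | _, e, .st (σ := σ) t => .node 6 σ.code (t.code e)
  | _, e, .allst σ φ => .node 7 σ.code (φ.code (Ext.number e))
  | _, e, .exst σ φ => .node 8 σ.code (φ.code (Ext.number e))

theorem Fml.code_injective {V : Ty → Type} (e : ∀ τ, V τ → ℕ)
    (he : ∀ τ, Function.Injective (e τ)) (φ ψ : Fml V) (h : φ.code e = ψ.code e) : φ = ψ := by
  induction φ with
  | bot => cases ψ <;> simp [Fml.code] at h ⊢
  | eq s t =>
    cases ψ <;> simp [Fml.code] at h
    rw [Tm.code_injective e he _ _ h.1, Tm.code_injective e he _ _ h.2]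
  | and φ₁ φ₂ ih₁ ih₂ | or φ₁ φ₂ ih₁ ih₂ | imp φ₁ φ₂ ih₁ ih₂ =>
    cases ψ <;> simp [Fml.code] at h
    rw [ih₁ e he _ h.1, ih₂ e he _ h.2]
  | st t =>
    cases ψ <;> simp [Fml.code, Ty.code_injective.eq_iff] at h
    obtain ⟨rfl, h⟩ := h
    rw [Tm.code_injective e he _ _ h]
  | all σ φ ih | ex σ φ ih | allst σ φ ih | exst σ φ ih =>
    cases ψ <;> simp [Fml.code, Ty.code_injective.eq_iff] at h
    obtain ⟨rfl, h⟩ := h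
    rw [ih _ (Ext.number_injective he) _ h]

instance : Countable (Fml Vars) :=
  Function.Injective.countable (f := Fml.code (V := Vars) fun _ x => x)
    fun φ ψ h => Fml.code_injective (V := Vars) _ (fun _ _ _ h => h) φ ψ h

/-! ## Fresh variables -/

/-- The finite set plays the role of the free variables. Only the agreement of substitutions on it
is ever needed, so it is described by that property. -/
theorem Tm.exists_support {V : Ty → Type} {σ : Ty} (t : Tm V σ) :
    ∃ S : Set (Σ τ, V τ), S.Finite ∧ ∀ (W : Ty → Type) (f g : Sub V W),
      (∀ τ x, ⟨τ, x⟩ ∈ S → f τ x = g τ x) → t.bind f = t.bind g := by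
  induction t with
  | var x => exact ⟨{⟨_, x⟩}, Set.finite_singleton _, fun W f g h => h _ _ rfl⟩
  | con c => exact ⟨∅, Set.finite_empty, fun W f g h => rfl⟩
  | app s t ihs iht =>
    obtain ⟨S, hS, h₁⟩ := ihs
    obtain ⟨S', hS', h₂⟩ := iht
    refine ⟨S ∪ S', hS.union hS', fun W f g h => ?_⟩
    rw [Tm.bind, Tm.bind, h₁ W f g fun τ x hx => h τ x (.inl hx),
      h₂ W f g fun τ x hx => h τ x (.inr hx)]

theorem Sub.lift_congr {V W : Ty → Type} {σ : Ty} {S : Set (Σ τ, Ext σ V τ)} {f g : Sub V W}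
    (h : ∀ τ x, (⟨τ, Ext.succ x⟩ : Σ τ, Ext σ V τ) ∈ S → f τ x = g τ x) (τ : Ty)
    (x : Ext σ V τ) (hx : ⟨τ, x⟩ ∈ S) : f.lift τ x = g.lift τ x := by
  cases x with
  | zero => rfl
  | succ x => exact congrArg Tm.wk (h _ x hx)

theorem Ext.finite_preimage_succ {V : Ty → Type} {σ : Ty} {S : Set (Σ τ, Ext σ V τ)}
    (hS : S.Finite) :
    {x : Σ τ, V τ | (⟨x.1, Ext.succ x.2⟩ : Σ τ, Ext σ V τ) ∈ S}.Finite := by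
  refine hS.preimage (f := fun x : Σ τ, V τ => (⟨x.1, Ext.succ x.2⟩ : Σ τ, Ext σ V τ)) ?_
  rintro ⟨τ, x⟩ _ ⟨τ', x'⟩ _ h
  simp only [Sigma.mk.injEq] at h
  obtain ⟨rfl, h⟩ := h
  cases h
  rfl

theorem Fml.exists_support {V : Ty → Type} (φ : Fml V) :
    ∃ S : Set (Σ τ, V τ), S.Finite ∧ ∀ (W : Ty → Type) (f g : Sub V W),
      (∀ τ x, ⟨τ, x⟩ ∈ S → f τ x = g τ x) → φ.bind f = φ.bind g := by
  induction φ with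
  | bot => exact ⟨∅, Set.finite_empty, fun W f g h => rfl⟩
  | eq s t =>
    obtain ⟨S, hS, h₁⟩ := s.exists_support
    obtain ⟨S', hS', h₂⟩ := t.exists_support
    refine ⟨S ∪ S', hS.union hS', fun W f g h => ?_⟩
    rw [Fml.bind, Fml.bind, h₁ W f g fun τ x hx => h τ x (.inl hx),
      h₂ W f g fun τ x hx => h τ x (.inr hx)]
  | st t =>
    obtain ⟨S, hS, h₁⟩ := t.exists_support
    refine ⟨S, hS, fun W f g h => ?_⟩
    rw [Fml.bind, Fml.bind, h₁ W f g h]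
  | and φ ψ ih₁ ih₂ | or φ ψ ih₁ ih₂ | imp φ ψ ih₁ ih₂ =>
    obtain ⟨S, hS, h₁⟩ := ih₁
    obtain ⟨S', hS', h₂⟩ := ih₂
    refine ⟨S ∪ S', hS.union hS', fun W f g h => ?_⟩
    rw [Fml.bind, Fml.bind, h₁ W f g fun τ x hx => h τ x (.inl hx),
      h₂ W f g fun τ x hx => h τ x (.inr hx)]
  | all σ φ ih | ex σ φ ih | allst σ φ ih | exst σ φ ih =>
    obtain ⟨S, hS, h₁⟩ := ih
    refine ⟨_, Ext.finite_preimage_succ hS, fun W f g h => ?_⟩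
    rw [Fml.bind, Fml.bind, h₁ _ f.lift g.lift (Sub.lift_congr h)]

theorem Fml.exists_support_list {V : Ty → Type} (Γ : List (Fml V)) :
    ∃ S : Set (Σ τ, V τ), S.Finite ∧ ∀ (W : Ty → Type) (f g : Sub V W),
      (∀ τ x, ⟨τ, x⟩ ∈ S → f τ x = g τ x) → ∀ φ ∈ Γ, φ.bind f = φ.bind g := by
  choose S hS h using fun φ : Fml V => φ.exists_support
  refine ⟨⋃ φ ∈ {φ | φ ∈ Γ}, S φ, (List.finite_toSet Γ).biUnion fun φ _ => hS φ,
    fun W f g hfg φ hφ => h φ W f g fun τ x hx => hfg τ x ?_⟩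
  exact Set.mem_biUnion (show φ ∈ {φ | φ ∈ Γ} from hφ) hx

open Classical in
/-- The substitution turning one variable into the newest variable and weakening the others. -/
noncomputable def Sub.abstractVar {V : Ty → Type} {σ : Ty} (y : V σ) : Sub V (Ext σ V) :=
  fun τ x => if h : (⟨τ, x⟩ : Σ τ, V τ) = ⟨σ, y⟩ then
    Tm.var (Eq.rec (motive := fun ρ _ => Ext σ V ρ) Ext.zero (congrArg Sigma.fst h).symm)
    else Tm.var (Ext.succ x)

theorem Sub.abstractVar_self {V : Ty → Type} {σ : Ty} (y : V σ) :
    Sub.abstractVar y σ y = Tm.var Ext.zero := by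
  simp [Sub.abstractVar]

theorem Sub.abstractVar_of_ne {V : Ty → Type} {σ τ : Ty} {y : V σ} {x : V τ}
    (h : (⟨τ, x⟩ : Σ τ, V τ) ≠ ⟨σ, y⟩) :
    Sub.abstractVar y τ x = Tm.var (Ext.succ x) := by
  simp only [Sub.abstractVar, dif_neg h]

/-- A fresh variable can replace the eigenvariable of an existential elimination. -/
theorem Prf.exE_fresh {T : AxSys} (hT : T.Closed) {Γ : List (Fml Vars)} {σ : Ty}
    {φ : Fml (Ext σ Vars)} :
    ∃ t : Tm Vars σ, ∀ Δ ⊆ Γ, Prf T (φ.inst t :: Δ) .bot → Prf T (.ex σ φ :: Δ) .bot := by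
  obtain ⟨S, hS, h⟩ := Fml.exists_support_list (.ex σ φ :: Γ)
  obtain ⟨y, hy⟩ : ∃ y : Vars σ, (⟨σ, y⟩ : Σ τ, Vars τ) ∉ S := by
    have : {y : ℕ | (⟨σ, y⟩ : Σ τ, Vars τ) ∈ S}.Finite :=
      hS.preimage (f := fun y : ℕ => (⟨σ, y⟩ : Σ τ, Vars τ)) fun a _ b _ h =>
        eq_of_heq (Sigma.mk.inj h).2
    exact this.infinite_compl.nonempty
  -- As y lies outside the support, abstracting it acts on these formulas as plain weakening, while
  -- it turns the instance of φ at y back into φ. The given derivation thereby becomes the premise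
  -- of `Prf.exE`.
  have hfresh : ∀ ψ ∈ Fml.ex σ φ :: Γ, ψ.bind (Sub.abstractVar y) = ψ.wk := by
    refine h _ _ _ fun τ x hx => Sub.abstractVar_of_ne ?_
    intro hxy
    exact hy (hxy ▸ hx)
  refine ⟨.var y, fun Δ hΔ hp => ?_⟩
  have hp := hp.bind hT (Sub.abstractVar y)
  refine .exE (.hyp List.mem_cons_self) (hp.weaken ?_)
  intro ψ hψ
  rw [List.map_cons, List.mem_cons] at hψ
  rcases hψ with rfl | hψ
  · have h₁ := hfresh _ List.mem_cons_self
    simp only [Fml.wk, Fml.bind, Fml.ex.injEq, heq_eq_eq, true_and] at h₁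
    rw [Fml.inst_bind, h₁]
    change Fml.inst _ (Sub.abstractVar y σ y) ∈ _
    rw [Sub.abstractVar_self]
    have := Fml.bind_lift_wk_inst φ
    rw [Tm.v0] at this
    rw [this]
    exact List.mem_cons_self
  · obtain ⟨χ, hχ, rfl⟩ := List.mem_map.1 hψ
    rw [hfresh χ (List.mem_cons_of_mem _ (hΔ hχ))]
    exact List.mem_cons_of_mem _ (List.mem_map_of_mem (List.mem_cons_of_mem _ hχ))

/-! ## Complete theories with witnesses -/

/-- The axiom system contains the law of excluded middle. -/
def AxSys.Classical (T : AxSys) : Prop := ∀ (V : Ty → Type) (φ : Fml V), φ.or φ.neg ∈ T V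

theorem classical_P_union_AC0st : (P.union AC0st).Classical :=
  fun _ φ => .inl (.inl (.inr (.lem φ)))

section
variable {T : AxSys} {V : Ty → Type} {Γ : List (Fml V)}

theorem Prf.cut {φ ψ : Fml V} (h : Prf T Γ φ) (h' : Prf T (φ :: Γ) ψ) : Prf T Γ ψ :=
  .impE (.impI h') h

theorem Prf.byCases (hL : T.Classical) {φ ψ : Fml V} (h₁ : Prf T (φ :: Γ) ψ)
    (h₂ : Prf T (φ.neg :: Γ) ψ) : Prf T Γ ψ :=
  .orE (.ax (hL V φ)) h₁ h₂

theorem Prf.byContra (hL : T.Classical) {φ : Fml V} (h : Prf T (φ.neg :: Γ) .bot) :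
    Prf T Γ φ :=
  .byCases hL (.hyp List.mem_cons_self) (.botE h)

theorem Prf.ex_neg_of_neg_all (hL : T.Classical) {σ : Ty} {φ : Fml (Ext σ V)}
    (h : Prf T Γ (Fml.all σ φ).neg) : Prf T Γ (.ex σ φ.neg) := by
  refine .byContra hL (.impE (h.weaken (List.subset_cons_self _ _)) (.allI (.byContra hL ?_)))
  refine .impE (φ := .ex σ (φ.neg.bind (Sub.wk1 (σ := σ)).lift))
    (.hyp (List.mem_cons_of_mem _ List.mem_cons_self)) (.exI Tm.v0 ?_)
  rw [Fml.bind_lift_wk_inst]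
  exact .hyp List.mem_cons_self

end

/-- A deductively closed, consistent and complete set of formulas with witnesses. -/
structure IsTruth (T : AxSys) (Tr : Fml Vars → Prop) : Prop where
  prf : ∀ {Γ : List (Fml Vars)} {φ : Fml Vars}, (∀ ψ ∈ Γ, Tr ψ) → Prf T Γ φ → Tr φ
  not_bot : ¬ Tr .bot
  em : ∀ φ : Fml Vars, Tr φ ∨ Tr φ.neg
  witness : ∀ {σ : Ty} {φ : Fml (Ext σ Vars)}, Tr (.ex σ φ) → ∃ t, Tr (φ.inst t)

/-- If χ is inconsistent with Γ, then Γ already derives its negation and is kept. Otherwise χ is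
added; when χ is existential, so is its instance at a fresh variable, and `Prf.exE_fresh` preserves
consistency. -/
theorem exists_henkin_step {T : AxSys} (hT : T.Closed) (χ : Fml Vars) (Γ : List (Fml Vars))
    (hΓ : ¬ Prf T Γ .bot) :
    ∃ Δ : List (Fml Vars), ¬ Prf T Δ .bot ∧ Γ ⊆ Δ ∧ (Prf T Δ χ ∨ Prf T Δ χ.neg) ∧
      ∀ (σ : Ty) (φ : Fml (Ext σ Vars)), χ = .ex σ φ → Prf T Δ χ → ∃ t, Prf T Δ (φ.inst t) := by
  by_cases h : Prf T (χ :: Γ) .bot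
  · refine ⟨Γ, hΓ, List.Subset.refl _, .inr (.impI h), fun σ φ _ h' => (hΓ (h'.cut h)).elim⟩
  by_cases hex : ∃ (σ : Ty) (φ : Fml (Ext σ Vars)), χ = .ex σ φ
  · obtain ⟨σ, φ, rfl⟩ := hex
    obtain ⟨t, ht⟩ := Prf.exE_fresh hT (Γ := .ex σ φ :: Γ) (φ := φ)
    refine ⟨φ.inst t :: .ex σ φ :: Γ, fun hp => h ?_,
      fun ψ hψ => List.mem_cons_of_mem _ (List.mem_cons_of_mem _ hψ),
      .inl (.hyp (List.mem_cons_of_mem _ List.mem_cons_self)), ?_⟩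
    · exact (Prf.hyp List.mem_cons_self).cut (ht _ (List.Subset.refl _) hp)
    · rintro σ' φ' h _
      cases h
      exact ⟨t, .hyp List.mem_cons_self⟩
  · exact ⟨χ :: Γ, h, List.subset_cons_self _ _, .inl (.hyp List.mem_cons_self),
      fun σ φ h' => (hex ⟨σ, φ, h'⟩).elim⟩

/-- The language is countable, so all formulas can be decided one after the other, starting from the
negation of A. Truth is derivability from some stage of the resulting chain. -/
theorem exists_isTruth {T : AxSys} (hT : T.Closed) (hL : T.Classical) {A : Fml Vars}
    (hA : ¬ T.Proves A) : ∃ Tr, IsTruth T Tr ∧ ¬ Tr A := by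
  obtain ⟨en, hen⟩ := @exists_surjective_nat (Fml Vars) ⟨.bot⟩ _
  choose! step hcons hsub hdec hwit using fun χ Γ => exists_henkin_step hT (T := T) χ Γ
  let G : ℕ → List (Fml Vars) := fun k => Nat.rec [A.neg] (fun k Γ => step (en k) Γ) k
  have hG : ∀ k, ¬ Prf T (G k) .bot := by
    intro k
    induction k with
    | zero => exact fun h => hA (.byContra hL h)
    | succ k ih => exact hcons _ _ ih
  have hmono : ∀ {k l}, k ≤ l → G k ⊆ G l := by
    intro k l h
    induction h with
    | refl => exact List.Subset.refl _
    | step _ ih => exact List.Subset.trans ih (hsub _ _ (hG _))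
  have hprf : ∀ {Γ : List (Fml Vars)} {φ : Fml Vars}, (∀ ψ ∈ Γ, ∃ k, Prf T (G k) ψ) →
      Prf T Γ φ → ∃ k, Prf T (G k) φ := by
    intro Γ
    induction Γ with
    | nil => exact fun _ h => ⟨0, h.weaken (List.nil_subset _)⟩
    | cons χ Γ ih =>
      intro φ h hp
      obtain ⟨k, hk⟩ := ih (fun ψ hψ => h ψ (List.mem_cons_of_mem _ hψ)) (.impI hp)
      obtain ⟨l, hl⟩ := h χ List.mem_cons_self
      exact ⟨max k l, .impE (hk.weaken (hmono (le_max_left _ _)))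
        (hl.weaken (hmono (le_max_right _ _)))⟩
  refine ⟨fun φ => ∃ k, Prf T (G k) φ, ⟨hprf, fun ⟨k, hk⟩ => hG k hk, fun φ => ?_, ?_⟩, ?_⟩
  · obtain ⟨k, rfl⟩ := hen φ
    exact (hdec (en k) (G k) (hG k)).imp (fun h => ⟨k + 1, h⟩) (fun h => ⟨k + 1, h⟩)
  · rintro σ φ ⟨l, hl⟩
    obtain ⟨k, hk⟩ := hen (.ex σ φ)
    rcases hdec (en k) (G k) (hG k) with h | h
    · obtain ⟨t, ht⟩ := hwit (en k) (G k) (hG k) σ φ hk h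
      exact ⟨t, k + 1, ht⟩
    -- The existential formula is derivable at stage l, so its refutation at stage k + 1 makes the
    -- later of the two stages inconsistent.
    · have h' : Prf T (G (k + 1)) (Fml.ex σ φ).neg := by
        rw [← hk]
        exact h
      exact (hG (max (k + 1) l) (.impE (h'.weaken (hmono (le_max_left (k + 1) l)))
        (hl.weaken (hmono (le_max_right _ _))))).elim
  · rintro ⟨k, hk⟩
    exact hG k (.impE (.hyp (hmono (Nat.zero_le k) List.mem_cons_self)) hk)

/-! ### Truth conditions of the connectives and quantifiers -/

namespace IsTruth
variable {T : AxSys} {Tr : Fml Vars → Prop} (h : IsTruth T Tr)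
include h

theorem ax {φ : Fml Vars} (hφ : φ ∈ T Vars) : Tr φ := h.prf (Γ := []) (by simp) (.ax hφ)

theorem imp_iff {φ ψ : Fml Vars} : Tr (.imp φ ψ) ↔ (Tr φ → Tr ψ) := by
  constructor
  · intro h₁ h₂
    refine h.prf (Γ := [.imp φ ψ, φ]) (by simp [h₁, h₂])
      (.impE (φ := φ) (.hyp (by simp)) (.hyp (by simp)))
  · intro h₁
    rcases h.em φ with h₂ | h₂
    · exact h.prf (Γ := [ψ]) (by simp [h₁ h₂]) (.impI (.hyp (by simp)))
    · exact h.prf (Γ := [φ.neg]) (by simp [h₂])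
        (.impI (.botE (.impE (.hyp (List.mem_cons_of_mem _ List.mem_cons_self))
          (.hyp (by simp)))))

theorem bot_iff : Tr .bot ↔ False := ⟨h.not_bot, False.elim⟩

theorem neg_iff {φ : Fml Vars} : Tr φ.neg ↔ ¬ Tr φ := by
  rw [Fml.neg, h.imp_iff, h.bot_iff]

theorem and_iff {φ ψ : Fml Vars} : Tr (.and φ ψ) ↔ Tr φ ∧ Tr ψ := by
  constructor
  · intro h₁
    exact ⟨h.prf (Γ := [.and φ ψ]) (by simp [h₁]) (.andE₁ (.hyp List.mem_cons_self)),
      h.prf (Γ := [.and φ ψ]) (by simp [h₁]) (.andE₂ (.hyp List.mem_cons_self))⟩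
  · rintro ⟨h₁, h₂⟩
    exact h.prf (Γ := [φ, ψ]) (by simp [h₁, h₂]) (.andI (.hyp (by simp)) (.hyp (by simp)))

theorem or_iff {φ ψ : Fml Vars} : Tr (.or φ ψ) ↔ Tr φ ∨ Tr ψ := by
  constructor
  · intro h₁
    by_contra! h₂
    rw [← h.neg_iff, ← h.neg_iff] at h₂
    refine h.not_bot (h.prf (Γ := [.or φ ψ, φ.neg, ψ.neg]) (by simp [h₁, h₂]) ?_)
    exact .orE (φ := φ) (ψ := ψ) (.hyp (by simp)) (.impE (φ := φ) (.hyp (by simp [Fml.neg])) (.hyp (by simp)))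
      (.impE (φ := ψ) (.hyp (by simp [Fml.neg])) (.hyp (by simp)))
  · rintro (h₁ | h₁)
    · exact h.prf (Γ := [φ]) (by simp [h₁]) (.orI₁ (.hyp (by simp)))
    · exact h.prf (Γ := [ψ]) (by simp [h₁]) (.orI₂ (.hyp (by simp)))

theorem ex_iff {σ : Ty} {φ : Fml (Ext σ Vars)} : Tr (.ex σ φ) ↔ ∃ t, Tr (φ.inst t) :=
  ⟨h.witness, fun ⟨t, ht⟩ => h.prf (Γ := [φ.inst t]) (by simp [ht]) (.exI t (.hyp (by simp)))⟩

theorem all_iff (hL : T.Classical) {σ : Ty} {φ : Fml (Ext σ Vars)} :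
    Tr (.all σ φ) ↔ ∀ t, Tr (φ.inst t) := by
  constructor
  · exact fun h₁ t => h.prf (Γ := [.all σ φ]) (by simp [h₁]) (.allE t (.hyp (by simp)))
  · intro h₁
    by_contra h₂
    rw [← h.neg_iff] at h₂
    obtain ⟨t, ht⟩ := h.witness
      (h.prf (Γ := [(Fml.all σ φ).neg]) (by simp [h₂]) (.ex_neg_of_neg_all hL (φ := φ) (.hyp (by simp))))
    exact (h.neg_iff (φ := φ.inst t)).1 ht (h₁ t)

theorem iff_iff {φ ψ : Fml Vars} : Tr (φ.iff ψ) ↔ (Tr φ ↔ Tr ψ) := by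
  rw [Fml.iff, h.and_iff, h.imp_iff, h.imp_iff]
  exact iff_iff_implies_and_implies.symm

end IsTruth

/-! ## Models -/

/-- Structures for the language, with equality interpreted as identity. -/
structure Model : Type 1 where
  D : Ty → Type
  app : ∀ {σ τ : Ty}, D (σ ⇾ τ) → D σ → D τ
  con : ∀ {σ : Ty}, Con σ → D σ
  st : ∀ {σ : Ty}, D σ → Prop

/-- Assignments of objects of a model to variables. -/
def Env (V : Ty → Type) (M : Model) : Type := ∀ τ : Ty, V τ → M.D τ

/-- The assignment giving the newest variable the value `a`. -/
def Env.cons {V : Ty → Type} {M : Model} {σ : Ty} (a : M.D σ) (e : Env V M) : Env (Ext σ V) M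
  | _, Ext.zero => a
  | _, Ext.succ x => e _ x

/-- The value of a term. -/
def Tm.eval {V : Ty → Type} {M : Model} (e : Env V M) : {σ : Ty} → Tm V σ → M.D σ
  | _, .var x => e _ x
  | _, .con c => M.con c
  | _, .app s t => M.app (s.eval e) (t.eval e)

/-- Composition of a substitution with an assignment. -/
def Sub.eval {V W : Ty → Type} {M : Model} (f : Sub V W) (e : Env W M) : Env V M :=
  fun τ x => (f τ x).eval e

/-- Satisfaction. -/
def Fml.Sat {M : Model} : {V : Ty → Type} → Fml V → Env V M → Prop
  | _, .eq s t, e => s.eval e = t.eval e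
  | _, .bot, _ => False
  | _, .and φ ψ, e => φ.Sat e ∧ ψ.Sat e
  | _, .or φ ψ, e => φ.Sat e ∨ ψ.Sat e
  | _, .imp φ ψ, e => φ.Sat e → ψ.Sat e
  | _, .all σ φ, e => ∀ a : M.D σ, φ.Sat (e.cons a)
  | _, .ex σ φ, e => ∃ a : M.D σ, φ.Sat (e.cons a)
  | _, .st t, e => M.st (t.eval e)
  | _, .allst σ φ, e => ∀ a : M.D σ, M.st a → φ.Sat (e.cons a)
  | _, .exst σ φ, e => ∃ a : M.D σ, M.st a ∧ φ.Sat (e.cons a)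

section
variable {M : Model} {V W : Ty → Type}

theorem Tm.eval_bind (f : Sub V W) (e : Env W M) {σ : Ty} (t : Tm V σ) :
    (t.bind f).eval e = t.eval (f.eval e) := by
  induction t with
  | var x => rfl
  | con c => rfl
  | app s t ihs iht => simp [Tm.bind, Tm.eval, ihs, iht]

theorem Sub.eval_cons {σ : Ty} (a : Tm W σ) (f : Sub V W) (e : Env W M) :
    (Sub.cons a f).eval e = (f.eval e).cons (a.eval e) := by
  funext τ x
  cases x <;> rfl

theorem Sub.eval_wk1 {σ : Ty} (a : M.D σ) (e : Env V M) :
    (Sub.wk1 (σ := σ)).eval (e.cons a) = e := rfl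

theorem Sub.eval_wk2 {σ τ : Ty} (a : M.D σ) (b : M.D τ) (e : Env V M) :
    (Sub.wk2 (σ := σ) (τ := τ)).eval ((e.cons a).cons b) = e := rfl

theorem Sub.eval_wk3 {σ τ ρ : Ty} (a : M.D σ) (b : M.D τ) (c : M.D ρ) (e : Env V M) :
    (Sub.wk3 (σ := σ) (τ := τ) (ρ := ρ)).eval (((e.cons a).cons b).cons c) = e := rfl

theorem Sub.eval_id (e : Env V M) : (Sub.id V).eval e = e := rfl

theorem Tm.eval_wk {σ τ : Ty} (a : M.D σ) (e : Env V M) (t : Tm V τ) :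
    t.wk.eval (e.cons a) = t.eval e := Tm.eval_bind _ _ t

theorem Tm.eval_v0 {σ : Ty} (a : M.D σ) (e : Env V M) : Tm.v0.eval (e.cons a) = a := rfl

theorem Tm.eval_v1 {σ τ : Ty} (a : M.D σ) (b : M.D τ) (e : Env V M) :
    Tm.v1.eval ((e.cons a).cons b) = a := rfl

theorem Tm.eval_v2 {σ τ ρ : Ty} (a : M.D σ) (b : M.D τ) (c : M.D ρ) (e : Env V M) :
    Tm.v2.eval (((e.cons a).cons b).cons c) = a := rfl

theorem Tm.eval_v3 {σ τ ρ μ : Ty} (a : M.D σ) (b : M.D τ) (c : M.D ρ) (d : M.D μ)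
    (e : Env V M) : Tm.v3.eval ((((e.cons a).cons b).cons c).cons d) = a := rfl

theorem Sub.eval_lift {σ : Ty} (f : Sub V W) (e : Env W M) (a : M.D σ) :
    f.lift.eval (e.cons a) = (f.eval e).cons a := by
  funext τ x
  cases x with
  | zero => rfl
  | succ x => exact Tm.eval_wk a e (f _ x)

theorem Fml.sat_bind (f : Sub V W) (e : Env W M) (φ : Fml V) :
    (φ.bind f).Sat e ↔ φ.Sat (f.eval e) := by
  induction φ generalizing W with
  | eq s t => simp [Fml.bind, Fml.Sat, Tm.eval_bind]
  | bot => rfl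
  | st t => simp [Fml.bind, Fml.Sat, Tm.eval_bind]
  | and φ ψ ih₁ ih₂ | or φ ψ ih₁ ih₂ | imp φ ψ ih₁ ih₂ => simp [Fml.bind, Fml.Sat, ih₁, ih₂]
  | all σ φ ih | ex σ φ ih | allst σ φ ih | exst σ φ ih =>
    simp [Fml.bind, Fml.Sat, ih, Sub.eval_lift]

end

/-- The system `P` with the schema of countable standard choice. -/
abbrev PAC : AxSys := P.union AC0st

theorem EHA.mem_PAC {V : Ty → Type} {φ : Fml V} (h : EHA V φ) : φ ∈ PAC V :=
  .inl (.inl (.inl (.inl h)))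

theorem StAx.mem_PAC {V : Ty → Type} {φ : Fml V} (h : StAx V φ) : φ ∈ PAC V :=
  .inl (.inl (.inl (.inr h)))

/-- Models of the axioms in which definable equality is identity. -/
structure Model.Good (M : Model) : Prop where
  sat : ∀ {V : Ty → Type} {φ : Fml V}, φ ∈ PAC V → ∀ e : Env V M, φ.Sat e
  eqAt_iff : ∀ {V : Ty → Type} (e : Env V M) {σ : Ty} (s t : Tm V σ),
    (Fml.eqAt σ s t).Sat e ↔ s.eval e = t.eval e

/-! ### The term model -/

namespace IsTruth
variable {Tr : Fml Vars → Prop} (h : IsTruth PAC Tr)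
include h

theorem eq_refl (s : Tm Vars .nat) : Tr (.eq s s) := h.ax (EHA.eqRefl s).mem_PAC

theorem eq_symm {s t : Tm Vars .nat} (h₁ : Tr (.eq s t)) : Tr (.eq t s) :=
  h.imp_iff.1 (h.ax (EHA.eqSymm s t).mem_PAC) h₁

theorem eq_trans {s t u : Tm Vars .nat} (h₁ : Tr (.eq s t)) (h₂ : Tr (.eq t u)) :
    Tr (.eq s u) :=
  h.imp_iff.1 (h.ax (EHA.eqTrans s t u).mem_PAC) (h.and_iff.2 ⟨h₁, h₂⟩)

theorem all_iff' {σ : Ty} {φ : Fml (Ext σ Vars)} : Tr (.all σ φ) ↔ ∀ t, Tr (φ.inst t) :=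
  h.all_iff classical_P_union_AC0st

theorem eqAt_arr_iff {σ τ : Ty} {s t : Tm Vars (σ ⇾ τ)} :
    Tr (.eqAt _ s t) ↔ ∀ x, Tr (.eqAt τ (.app s x) (.app t x)) := by
  rw [Fml.eqAt, h.all_iff']
  simp only [Fml.inst, Fml.eqAt_bind, Tm.bind, Tm.wk_bind_cons, Tm.bind_id, Tm.v0_bind_cons]

theorem lt_iff {s t : Tm Vars .nat} :
    Tr (.lt s t) ↔ ∃ x : Tm Vars .nat, Tr (.eq (.add s x.succ) t) := by
  rw [Fml.lt, h.ex_iff]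
  simp only [Fml.inst, Fml.bind, Tm.add_bind, Tm.succ_bind, Tm.wk_bind_cons, Tm.bind_id,
    Tm.v0_bind_cons]

theorem eqAt_seq_iff {σ : Ty} {s t : Tm Vars (.seq σ)} :
    Tr (.eqAt _ s t) ↔ Tr (.eq s.len t.len) ∧
      ∀ i, Tr (.lt i s.len) → Tr (.eqAt σ (.get s i) (.get t i)) := by
  rw [Fml.eqAt, h.and_iff, h.all_iff']
  simp only [Fml.inst, Fml.bind, Fml.eqAt_bind, Fml.lt_bind, Tm.get_bind, Tm.len_bind,
    Tm.wk_bind_cons, Tm.bind_id, Tm.v0_bind_cons, h.imp_iff]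

theorem lt_congr {i s t : Tm Vars .nat} (h₁ : Tr (.eq s t)) (h₂ : Tr (.lt i s)) :
    Tr (.lt i t) := by
  obtain ⟨x, hx⟩ := h.lt_iff.1 h₂
  exact h.lt_iff.2 ⟨x, h.eq_trans hx h₁⟩

/-- Only type 0 has equality axioms; higher types inherit them by induction. For sequences, the
bound on the index must be carried along the equality of lengths. -/
theorem eqAt_equivalence (σ : Ty) :
    Equivalence fun s t : Tm Vars σ => Tr (.eqAt σ s t) := by
  induction σ with
  | nat => exact ⟨h.eq_refl, h.eq_symm, h.eq_trans⟩
  | arr σ τ _ ih =>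
    simp only [h.eqAt_arr_iff]
    exact ⟨fun s x => ih.refl _, fun h₁ x => ih.symm (h₁ x),
      fun h₁ h₂ x => ih.trans (h₁ x) (h₂ x)⟩
  | seq σ ih =>
    simp only [h.eqAt_seq_iff]
    refine ⟨fun s => ⟨h.eq_refl _, fun i _ => ih.refl _⟩,
      fun h₁ => ⟨h.eq_symm h₁.1, fun i hi => ih.symm (h₁.2 i (h.lt_congr (h.eq_symm h₁.1) hi))⟩,
      fun h₁ h₂ => ⟨h.eq_trans h₁.1 h₂.1, fun i hi => ih.trans (h₁.2 i hi)
        (h₂.2 i (h.lt_congr h₁.1 hi))⟩⟩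

/-- Provable equality of terms. -/
def termSetoid (σ : Ty) : Setoid (Tm Vars σ) := ⟨_, h.eqAt_equivalence σ⟩

/-- The extensionality axiom changes the argument, and the definition of equality at arrow types
changes the function. This makes application well defined on classes. -/
theorem eqAt_app {σ τ : Ty} {s s' : Tm Vars (σ ⇾ τ)} {t t' : Tm Vars σ}
    (h₁ : Tr (.eqAt _ s s')) (h₂ : Tr (.eqAt _ t t')) :
    Tr (.eqAt _ (.app s t) (.app s' t')) :=
  (h.eqAt_equivalence τ).trans (h.imp_iff.1 (h.ax (EHA.ext s t t').mem_PAC) h₂)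
    (h.eqAt_arr_iff.1 h₁ t')

theorem st_congr {σ : Ty} {s t : Tm Vars σ} (h₁ : Tr (.eqAt _ s t)) (h₂ : Tr (.st s)) :
    Tr (.st t) :=
  h.imp_iff.1 (h.ax (StAx.stEq s t).mem_PAC) (h.and_iff.2 ⟨h₂, h₁⟩)

/-- The term model. -/
def model : Model where
  D σ := Quotient (h.termSetoid σ)
  app := Quotient.map₂ Tm.app fun _ _ h₁ _ _ h₂ => h.eqAt_app h₁ h₂
  con c := Quotient.mk _ (.con c)
  st := Quotient.lift (fun t => Tr (.st t)) fun _ _ h₁ =>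
    propext ⟨h.st_congr h₁, h.st_congr ((h.eqAt_equivalence _).symm h₁)⟩

/-- The assignment given by a substitution. -/
def env {V : Ty → Type} (f : Sub V Vars) : Env V h.model := fun _ x => Quotient.mk _ (f _ x)

theorem exists_env_eq {V : Ty → Type} (e : Env V h.model) : ∃ f, h.env f = e :=
  ⟨fun τ x => (e τ x).out, by funext τ x; exact Quotient.out_eq _⟩

theorem env_cons {V : Ty → Type} {σ : Ty} (t : Tm Vars σ) (f : Sub V Vars) :
    (h.env f).cons (Quotient.mk _ t) = h.env (Sub.cons t f) := by
  funext τ x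
  cases x <;> rfl

theorem eval_env {V : Ty → Type} {σ : Ty} (f : Sub V Vars) (t : Tm V σ) :
    t.eval (h.env f) = Quotient.mk _ (t.bind f) := by
  induction t with
  | var x => rfl
  | con c => rfl
  | app s t ihs iht => rw [Tm.eval, ihs, iht]; rfl

/-- The truth lemma. Every object is the class of a term, so quantifiers over objects match the
instances by terms; external quantifiers reduce to these by their defining axioms. -/
theorem sat_env {V : Ty → Type} (f : Sub V Vars) (φ : Fml V) :
    φ.Sat (h.env f) ↔ Tr (φ.bind f) := by
  have key : ∀ {V : Ty → Type} {σ : Ty} (φ : Fml (Ext σ V)) (f : Sub V Vars),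
      (∀ g : Sub (Ext σ V) Vars, φ.Sat (h.env g) ↔ Tr (φ.bind g)) →
      ∀ t : Tm Vars σ, φ.Sat ((h.env f).cons (Quotient.mk _ t)) ↔
        Tr ((φ.bind f.lift).inst t) := by
    intro V σ φ f ih t
    rw [h.env_cons, ih, Fml.bind_lift_inst]
  induction φ with
  | eq s t =>
    rw [Fml.Sat, h.eval_env, h.eval_env]
    exact Quotient.eq
  | bot => exact h.bot_iff.symm
  | and φ ψ ih₁ ih₂ => exact (and_congr (ih₁ f) (ih₂ f)).trans h.and_iff.symm
  | or φ ψ ih₁ ih₂ => exact (or_congr (ih₁ f) (ih₂ f)).trans h.or_iff.symm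
  | imp φ ψ ih₁ ih₂ => exact (imp_congr (ih₁ f) (ih₂ f)).trans h.imp_iff.symm
  | st t =>
    rw [Fml.Sat, h.eval_env]
    rfl
  | all σ φ ih =>
    rw [Fml.Sat, Fml.bind, h.all_iff']
    exact Quotient.forall.trans (forall_congr' (key φ f ih))
  | ex σ φ ih =>
    rw [Fml.Sat, Fml.bind, h.ex_iff]
    exact Quotient.exists.trans (exists_congr (key φ f ih))
  | allst σ φ ih =>
    rw [Fml.Sat, Fml.bind, h.iff_iff.1 (h.ax (StAx.allst _).mem_PAC), h.all_iff']
    refine Quotient.forall.trans (forall_congr' fun t => ?_)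
    rw [key φ f ih]
    exact (h.imp_iff (φ := .st t)).symm
  | exst σ φ ih =>
    rw [Fml.Sat, Fml.bind, h.iff_iff.1 (h.ax (StAx.exst _).mem_PAC), h.ex_iff]
    refine Quotient.exists.trans (exists_congr fun t => ?_)
    rw [key φ f ih]
    exact (h.and_iff (φ := .st t)).symm

/-- An assignment of any context comes from a substitution of terms for its variables, so closure of
the axioms under substitution suffices. Arbitrary contexts later permit the objects of the model
themselves to serve as variables. -/
theorem good_model : h.model.Good where
  sat {V φ} hφ e := by
    obtain ⟨f, rfl⟩ := h.exists_env_eq e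
    exact (h.sat_env f φ).2 (h.ax (closed_P_union_AC0st _ _ f φ hφ))
  eqAt_iff {V} e σ s t := by
    obtain ⟨f, rfl⟩ := h.exists_env_eq e
    rw [h.sat_env, Fml.eqAt_bind, h.eval_env, h.eval_env]
    exact (Quotient.eq (r := h.termSetoid σ)).symm

end IsTruth

/-- Completeness: what holds in all models is derivable. -/
theorem proves_of_forall_model {A : Fml Vars}
    (hA : ∀ M : Model, M.Good → ∀ e : Env Vars M, A.Sat e) : PAC.Proves A := by
  by_contra hn
  obtain ⟨Tr, h, hTr⟩ := exists_isTruth closed_P_union_AC0st classical_P_union_AC0st hn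
  refine hTr ?_
  have := (h.sat_env (Sub.id Vars) A).1 (hA h.model h.good_model _)
  rwa [Fml.bind_id] at this

/-! ## Operations of a model -/

namespace Model
variable (M : Model)

/-- The objects of a model as assignment to themselves. -/
def self : Env M.D M := fun _ x => x

/-- The empty assignment. -/
def nilEnv : Env (fun _ => Empty) M := fun _ x => x.elim

def zero : M.D .nat := M.con .zero
def succ (n : M.D .nat) : M.D .nat := M.app (M.con .succ) n
def recN {ρ : Ty} (n : M.D .nat) (y : M.D ρ) (z : M.D (ρ ⇾ .nat ⇾ ρ)) : M.D ρ :=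
  M.app (M.app (M.app (M.con (.recN ρ)) n) y) z
def nil (σ : Ty) : M.D (.seq σ) := M.con (.nil σ)
def cons {σ : Ty} (a : M.D σ) (s : M.D (.seq σ)) : M.D (.seq σ) :=
  M.app (M.app (M.con (.cons σ)) a) s
def recL {σ ρ : Ty} (s : M.D (.seq σ)) (y : M.D ρ) (z : M.D (ρ ⇾ σ ⇾ .seq σ ⇾ ρ)) : M.D ρ :=
  M.app (M.app (M.app (M.con (.recL σ ρ)) s) y) z
def dflt (σ : Ty) : M.D σ := (Tm.dflt σ).eval M.nilEnv
def add (m n : M.D .nat) : M.D .nat := (Tm.add Tm.v1 Tm.v0).eval ((M.nilEnv.cons m).cons n)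
def len {σ : Ty} (s : M.D (.seq σ)) : M.D .nat := (Tm.len Tm.v0).eval (M.nilEnv.cons s)
def get {σ : Ty} (s : M.D (.seq σ)) (i : M.D .nat) : M.D σ :=
  (Tm.get Tm.v1 Tm.v0).eval ((M.nilEnv.cons s).cons i)
def lt (m n : M.D .nat) : Prop := ∃ k, M.add m (M.succ k) = n
def mem {σ : Ty} (x : M.D σ) (s : M.D (.seq σ)) : Prop := ∃ i, M.lt i (M.len s) ∧ x = M.get s i

end Model

/-- The substitution without variables. -/
def Sub.elim (V : Ty → Type) : Sub (fun _ => Empty) V := fun _ x => x.elim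

section
variable {M : Model} {V : Ty → Type} (e : Env V M)

theorem Sub.eval_elim (f : Sub (fun _ => Empty) V) : f.eval e = M.nilEnv := by
  funext τ x
  exact x.elim

theorem Tm.eval_ofClosed {σ : Ty} (t : Tm (fun _ => Empty) σ) :
    (t.ofClosed (V := V)).eval e = t.eval M.nilEnv :=
  (Tm.eval_bind (Sub.elim V) e t).trans (by rw [Sub.eval_elim])

theorem Tm.eval_zero : (Tm.zero (V := V)).eval e = M.zero := rfl
theorem Tm.eval_succ (n : Tm V .nat) : n.succ.eval e = M.succ (n.eval e) := rfl
theorem Tm.eval_recN {ρ : Ty} (n : Tm V .nat) (y : Tm V ρ) (z : Tm V (ρ ⇾ .nat ⇾ ρ)) :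
    (Tm.recN n y z).eval e = M.recN (n.eval e) (y.eval e) (z.eval e) := rfl
theorem Tm.eval_nil (σ : Ty) : (Tm.nil (V := V) σ).eval e = M.nil σ := rfl
theorem Tm.eval_cons {σ : Ty} (a : Tm V σ) (s : Tm V (.seq σ)) :
    (Tm.cons a s).eval e = M.cons (a.eval e) (s.eval e) := rfl
theorem Tm.eval_recL {σ ρ : Ty} (s : Tm V (.seq σ)) (y : Tm V ρ)
    (z : Tm V (ρ ⇾ σ ⇾ .seq σ ⇾ ρ)) :
    (Tm.recL s y z).eval e = M.recL (s.eval e) (y.eval e) (z.eval e) := rfl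

theorem Tm.eval_dflt (σ : Ty) : (Tm.dflt (V := V) σ).eval e = M.dflt σ := by
  rw [← Tm.dflt_bind (Sub.elim V), Tm.eval_bind, Sub.eval_elim]
  rfl

theorem Tm.eval_add (m n : Tm V .nat) : (Tm.add m n).eval e = M.add (m.eval e) (n.eval e) := rfl

theorem Tm.eval_len {σ : Ty} (s : Tm V (.seq σ)) : s.len.eval e = M.len (s.eval e) := rfl

theorem Tm.eval_get {σ : Ty} (s : Tm V (.seq σ)) (i : Tm V .nat) :
    (Tm.get s i).eval e = M.get (s.eval e) (i.eval e) := by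
  have : Tm.get s i = (Tm.get (V := Ext _ (Ext _ fun _ => Empty)) Tm.v1 Tm.v0).bind
      (Sub.cons i (Sub.cons s (Sub.elim V))) := by
    rw [Tm.get_bind]
    rfl
  rw [this, Tm.eval_bind, Sub.eval_cons, Sub.eval_cons, Sub.eval_elim]
  rfl

theorem Fml.sat_lt (m n : Tm V .nat) : (Fml.lt m n).Sat e ↔ M.lt (m.eval e) (n.eval e) := by
  simp only [Fml.lt, Fml.Sat, Tm.eval_add, Tm.eval_succ, Tm.eval_wk, Tm.eval_v0, Model.lt]

theorem Fml.sat_neg (φ : Fml V) : φ.neg.Sat e ↔ ¬ φ.Sat e := Iff.rfl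

theorem Fml.sat_mem (hM : M.Good) {σ : Ty} (x : Tm V σ) (s : Tm V (.seq σ)) :
    (Fml.mem x s).Sat e ↔ M.mem (x.eval e) (s.eval e) := by
  simp only [Fml.mem, Fml.Sat, Fml.sat_lt, hM.eqAt_iff, Tm.eval_len, Tm.eval_get, Tm.eval_wk,
    Tm.eval_v0, Model.mem]

end

theorem Fml.internal_lt {V : Ty → Type} (m n : Tm V .nat) : (Fml.lt m n).Internal := trivial

theorem Fml.internal_eqAt {V : Ty → Type} (σ : Ty) (s t : Tm V σ) :
    (Fml.eqAt σ s t).Internal := by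
  induction σ generalizing V with
  | nat => trivial
  | arr σ τ _ ih => exact ih _ _
  | seq σ ih => exact ⟨trivial, Fml.internal_lt _ _, ih _ _⟩

theorem Fml.internal_mem {V : Ty → Type} {σ : Ty} (x : Tm V σ) (s : Tm V (.seq σ)) :
    (Fml.mem x s).Internal :=
  ⟨Fml.internal_lt _ _, Fml.internal_eqAt _ _ _⟩

/-! ### The axioms in a model -/

namespace Model.Good
variable {M : Model} (hM : M.Good)
include hM

theorem pi {σ τ : Ty} (x : M.D σ) (y : M.D τ) : M.app (M.app (M.con (.pi σ τ)) x) y = x :=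
  (hM.eqAt_iff M.self _ _).1 (hM.sat (EHA.pi (.var x) (.var y)).mem_PAC M.self)

theorem sigma {ρ σ τ : Ty} (x : M.D (ρ ⇾ σ ⇾ τ)) (y : M.D (ρ ⇾ σ)) (z : M.D ρ) :
    M.app (M.app (M.app (M.con (.sigma ρ σ τ)) x) y) z = M.app (M.app x z) (M.app y z) :=
  (hM.eqAt_iff M.self _ _).1 (hM.sat (EHA.sigma (.var x) (.var y) (.var z)).mem_PAC M.self)

theorem recN_zero {ρ : Ty} (y : M.D ρ) (z : M.D (ρ ⇾ .nat ⇾ ρ)) : M.recN M.zero y z = y :=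
  (hM.eqAt_iff M.self _ _).1 (hM.sat (EHA.recZero (.var y) (.var z)).mem_PAC M.self)

theorem recN_succ {ρ : Ty} (n : M.D .nat) (y : M.D ρ) (z : M.D (ρ ⇾ .nat ⇾ ρ)) :
    M.recN (M.succ n) y z = M.app (M.app z (M.recN n y z)) n :=
  (hM.eqAt_iff M.self _ _).1 (hM.sat (EHA.recSucc (.var n) (.var y) (.var z)).mem_PAC M.self)

theorem recL_nil {σ ρ : Ty} (y : M.D ρ) (z : M.D (ρ ⇾ σ ⇾ .seq σ ⇾ ρ)) :
    M.recL (M.nil σ) y z = y :=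
  (hM.eqAt_iff M.self _ _).1 (hM.sat (EHA.recNil (.var y) (.var z)).mem_PAC M.self)

theorem recL_cons {σ ρ : Ty} (a : M.D σ) (s : M.D (.seq σ)) (y : M.D ρ)
    (z : M.D (ρ ⇾ σ ⇾ .seq σ ⇾ ρ)) :
    M.recL (M.cons a s) y z = M.app (M.app (M.app z (M.recL s y z)) a) s :=
  (hM.eqAt_iff M.self _ _).1
    (hM.sat (EHA.recCons (.var a) (.var s) (.var y) (.var z)).mem_PAC M.self)

theorem succ_ne_zero (n : M.D .nat) : M.succ n ≠ M.zero :=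
  hM.sat (EHA.succNeZero (.var n)).mem_PAC M.self

theorem succ_inj {m n : M.D .nat} (h : M.succ m = M.succ n) : m = n :=
  hM.sat (EHA.succInj (.var m) (.var n)).mem_PAC M.self h

theorem funext {σ τ : Ty} {f g : M.D (σ ⇾ τ)} (h : ∀ x, M.app f x = M.app g x) : f = g := by
  refine (hM.eqAt_iff M.self (.var f) (.var g)).1 ?_
  intro x
  exact (hM.eqAt_iff _ _ _).2 (h x)

theorem seq_cases {σ : Ty} (s : M.D (.seq σ)) : s = M.nil σ ∨ ∃ a t, s = M.cons a t := by
  have := hM.sat (EHA.seqCases (.var s)).mem_PAC M.self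
  simp only [Fml.Sat, hM.eqAt_iff, Tm.eval_wk, Tm.eval_cons, Tm.eval_v0, Tm.eval_v1] at this
  exact this

theorem st_app {σ τ : Ty} {f : M.D (σ ⇾ τ)} {x : M.D σ} (hf : M.st f) (hx : M.st x) :
    M.st (M.app f x) :=
  hM.sat (StAx.stApp (.var f) (.var x)).mem_PAC M.self ⟨hf, hx⟩

theorem st_con {σ : Ty} (c : Con σ) : M.st (M.con c) :=
  hM.sat (StAx.stClosed (.con c)).mem_PAC M.self

theorem st_eval {V : Ty → Type} (e : Env V M) (he : ∀ τ x, M.st (e τ x)) {σ : Ty}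
    (t : Tm V σ) : M.st (t.eval e) := by
  induction t with
  | var x => exact he _ x
  | con c => exact hM.st_con c
  | app s t ihs iht => exact hM.st_app ihs iht

omit hM in
theorem st_env_cons {V : Ty → Type} {e : Env V M} (he : ∀ τ x, M.st (e τ x)) {σ : Ty}
    {a : M.D σ} (ha : M.st a) (τ : Ty) (x : Ext σ V τ) : M.st (e.cons a τ x) := by
  cases x with
  | zero => exact ha
  | succ x => exact he _ x

theorem st_closed {σ : Ty} (t : Tm (fun _ => Empty) σ) : M.st (t.eval M.nilEnv) :=
  hM.st_eval _ (fun _ x => x.elim) t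

theorem st_zero : M.st M.zero := hM.st_con _

theorem st_dflt (σ : Ty) : M.st (M.dflt σ) := hM.st_closed _

theorem st_len {σ : Ty} {s : M.D (.seq σ)} (h : M.st s) : M.st (M.len s) :=
  hM.st_eval _ (st_env_cons (fun _ x => x.elim) h) _

theorem st_get {σ : Ty} {s : M.D (.seq σ)} {i : M.D .nat} (h : M.st s) (hi : M.st i) :
    M.st (M.get s i) :=
  hM.st_eval _ (st_env_cons (st_env_cons (fun _ x => x.elim) h) hi) _

theorem ind {V : Ty → Type} (e : Env V M) (φ : Fml (Ext .nat V)) (hφ : φ.Internal)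
    (h0 : φ.Sat (e.cons M.zero))
    (hs : ∀ n, φ.Sat (e.cons n) → φ.Sat (e.cons (M.succ n))) (n : M.D .nat) :
    φ.Sat (e.cons n) := by
  have := hM.sat (EHA.ind φ hφ).mem_PAC e
  simp only [Fml.Sat, Fml.inst, Fml.sat_bind, Sub.eval_cons, Sub.eval_id, Sub.eval_wk1,
    Tm.eval_zero, Tm.eval_succ, Tm.eval_v0] at this
  exact this ⟨h0, hs⟩ n

theorem ind_st {V : Ty → Type} (e : Env V M) (Φ : Fml (Ext .nat V))
    (h0 : Φ.Sat (e.cons M.zero))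
    (hs : ∀ n, M.st n → Φ.Sat (e.cons n) → Φ.Sat (e.cons (M.succ n))) (n : M.D .nat)
    (hn : M.st n) : Φ.Sat (e.cons n) := by
  have := hM.sat (StAx.indSt Φ).mem_PAC e
  simp only [Fml.Sat, Fml.inst, Fml.sat_bind, Sub.eval_cons, Sub.eval_id, Sub.eval_wk1,
    Tm.eval_zero, Tm.eval_succ, Tm.eval_v0] at this
  exact this ⟨h0, hs⟩ n hn

theorem ideal {V : Ty → Type} {σ τ : Ty} (e : Env V M) (φ : Fml (Ext τ (Ext σ V)))
    (hφ : φ.Internal)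
    (h : ∀ s, M.st s → ∃ y, ∀ x, M.mem x s → φ.Sat ((e.cons x).cons y)) :
    ∃ y, ∀ x, M.st x → φ.Sat ((e.cons x).cons y) := by
  have := hM.sat (V := V) (.inl (.inr (.ideal φ hφ))) e
  simp only [idealisation, Fml.Sat, Fml.sat_bind, Sub.eval_cons, Sub.eval_wk2, Sub.eval_wk3,
    Fml.sat_mem _ hM, Tm.eval_v0, Tm.eval_v1, Tm.eval_v2] at this
  exact this h

theorem hac {V : Ty → Type} {σ τ : Ty} (e : Env V M) (φ : Fml (Ext τ (Ext σ V)))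
    (hφ : φ.Internal)
    (h : ∀ x, M.st x → ∃ y, M.st y ∧ φ.Sat ((e.cons x).cons y)) :
    ∃ F : M.D (σ ⇾ .seq τ), M.st F ∧
      ∀ x, M.st x → ∃ y, M.mem y (M.app F x) ∧ φ.Sat ((e.cons x).cons y) := by
  have := hM.sat (V := V) (.inl (.inr (.hac φ hφ))) e
  simp only [herbrandChoice, Fml.Sat, Fml.sat_bind, Sub.eval_cons, Sub.eval_wk3,
    Fml.sat_mem _ hM, Tm.eval, Tm.eval_v0, Tm.eval_v1, Tm.eval_v2] at this
  exact this h

theorem choice {V : Ty → Type} {σ : Ty} (e : Env V M) (Φ : Fml (Ext σ (Ext .nat V)))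
    (h : ∀ n, M.st n → ∃ x, M.st x ∧ Φ.Sat ((e.cons n).cons x)) :
    ∃ f : M.D (.nat ⇾ σ), M.st f ∧ ∀ n, M.st n → Φ.Sat ((e.cons n).cons (M.app f n)) := by
  have := hM.sat (V := V) (.inr ⟨σ, Φ, rfl⟩) e
  simp only [choiceSt, Fml.Sat, Fml.sat_bind, Sub.eval_cons, Sub.eval_wk2,
    Tm.eval, Tm.eval_v0, Tm.eval_v1] at this
  exact this h

/-- The combinators satisfy the rule of beta conversion. -/
theorem beta {V : Ty → Type} {σ τ : Ty} (e : Env V M) (t : Tm (Ext σ V) τ) (a : M.D σ) :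
    M.app (t.lam.eval e) a = t.eval (e.cons a) := by
  induction t with
  | var x =>
    cases x with
    | zero => exact (hM.sigma _ _ _).trans (hM.pi _ _)
    | succ x => exact hM.pi _ _
  | con c => exact hM.pi _ _
  | app s t ihs iht =>
    refine (hM.sigma _ _ _).trans ?_
    rw [ihs, iht]
    rfl

/-! ### Arithmetic and finite sequences -/

theorem nat_cases (n : M.D .nat) : n = M.zero ∨ ∃ k, n = M.succ k := by
  have := hM.ind M.self (.or (.eq Tm.v0 Tm.zero) (.ex .nat (.eq Tm.v1 (Tm.succ Tm.v0))))
    ⟨trivial, trivial⟩ (.inl rfl) (fun n _ => .inr ⟨n, rfl⟩) n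
  exact this

theorem add_zero (m : M.D .nat) : M.add m M.zero = m := hM.recN_zero _ _

theorem add_succ (m n : M.D .nat) : M.add m (M.succ n) = M.succ (M.add m n) := by
  refine (hM.recN_succ _ _ _).trans ?_
  simp only [hM.beta, Tm.eval_succ, Tm.eval_v1]
  rfl

theorem succ_add (m n : M.D .nat) : M.add (M.succ m) n = M.succ (M.add m n) := by
  refine hM.ind M.self (.eq (.add (.succ (.var (.succ m))) Tm.v0)
    (.succ (.add (.var (.succ m)) Tm.v0))) trivial ?_ ?_ n
  · change M.add (M.succ m) M.zero = M.succ (M.add m M.zero)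
    rw [hM.add_zero, hM.add_zero]
  · intro n ih
    change M.add (M.succ m) (M.succ n) = M.succ (M.add m (M.succ n))
    replace ih : M.add (M.succ m) n = M.succ (M.add m n) := ih
    rw [hM.add_succ, hM.add_succ, ih]

theorem not_lt_zero (n : M.D .nat) : ¬ M.lt n M.zero := by
  rintro ⟨k, hk⟩
  rw [hM.add_succ] at hk
  exact hM.succ_ne_zero _ hk

theorem lt_of_succ_lt_succ {m n : M.D .nat} (h : M.lt (M.succ m) (M.succ n)) : M.lt m n := by
  obtain ⟨k, hk⟩ := h
  rw [hM.succ_add] at hk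
  exact ⟨k, hM.succ_inj hk⟩

theorem lt_or_eq_of_lt_succ {m n : M.D .nat} (h : M.lt m (M.succ n)) : M.lt m n ∨ m = n := by
  obtain ⟨k, hk⟩ := h
  rw [hM.add_succ] at hk
  replace hk := hM.succ_inj hk
  rcases hM.nat_cases k with rfl | ⟨k, rfl⟩
  · rw [hM.add_zero] at hk
    exact .inr hk
  · exact .inl ⟨k, hk⟩

/-- External induction on the bound: a number below n + 1 is below n or equal to the standard n. -/
theorem st_of_lt {m n : M.D .nat} (hn : M.st n) (h : M.lt m n) : M.st m := by
  have key := hM.ind_st M.self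
    (.all .nat (.imp (.lt Tm.v0 Tm.v1) (.st (Tm.v0 (V := Ext .nat M.D))))) ?_ ?_ n hn
  · exact key m ((Fml.sat_lt _ _ _).2 h)
  · intro m hm
    exact (hM.not_lt_zero _ ((Fml.sat_lt _ _ _).1 hm)).elim
  · intro n hn ih m hm
    rcases hM.lt_or_eq_of_lt_succ ((Fml.sat_lt _ _ _).1 hm) with h | h
    · exact ih m ((Fml.sat_lt _ _ _).2 h)
    · exact h ▸ hn

/-- The length of s is standard, hence so is every index below it. Bounded witnesses from `HAC_int`
and from idealisation thereby become standard ones. -/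
theorem st_of_mem {σ : Ty} {x : M.D σ} {s : M.D (.seq σ)} (hs : M.st s) (h : M.mem x s) :
    M.st x := by
  obtain ⟨i, hi, rfl⟩ := h
  exact hM.st_get hs (hM.st_of_lt (hM.st_len hs) hi)

theorem len_nil (σ : Ty) : M.len (M.nil σ) = M.zero := hM.recL_nil _ _

theorem len_cons {σ : Ty} (a : M.D σ) (s : M.D (.seq σ)) :
    M.len (M.cons a s) = M.succ (M.len s) := by
  refine (hM.recL_cons _ _ _ _).trans ?_
  simp only [hM.beta, Tm.eval_succ, Tm.eval_v2]
  rfl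

theorem not_mem_nil {σ : Ty} (x : M.D σ) : ¬ M.mem x (M.nil σ) := by
  rintro ⟨i, hi, -⟩
  rw [hM.len_nil] at hi
  exact hM.not_lt_zero _ hi

theorem get_cons_zero {σ : Ty} (a : M.D σ) (s : M.D (.seq σ)) :
    M.get (M.cons a s) M.zero = a := by
  refine (congrArg (fun f => M.app f M.zero) (hM.recL_cons _ _ _ _)).trans ?_
  simp only [hM.beta, Tm.eval_recN, Tm.eval_v2]
  exact hM.recN_zero _ _

theorem get_cons_succ {σ : Ty} (a : M.D σ) (s : M.D (.seq σ)) (i : M.D .nat) :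
    M.get (M.cons a s) (M.succ i) = M.get s i := by
  refine (congrArg (fun f => M.app f (M.succ i)) (hM.recL_cons _ _ _ _)).trans ?_
  simp only [hM.beta, Tm.eval_recN, Tm.eval_v2]
  refine (hM.recN_succ _ _ _).trans ?_
  simp only [hM.beta, Tm.eval, Tm.eval_wk, Tm.eval_v0, Tm.eval_v3]
  -- The two sides evaluate the constant default function under different assignments;
  -- extensionality identifies the values.
  have key : ∀ e e' : Env (Ext .nat (Ext (.seq σ) fun _ => Empty)) M,
      (Tm.lam (σ := .nat) (Tm.dflt σ)).eval e = (Tm.lam (Tm.dflt σ)).eval e' := fun e e' =>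
    hM.funext fun x => by rw [hM.beta, hM.beta, Tm.eval_dflt, Tm.eval_dflt]
  rw [key _ ((M.nilEnv.cons s).cons i)]
  rfl

theorem mem_cons {σ : Ty} {x a : M.D σ} {s : M.D (.seq σ)} (h : M.mem x (M.cons a s)) :
    x = a ∨ M.mem x s := by
  obtain ⟨i, hi, rfl⟩ := h
  rw [hM.len_cons] at hi
  rcases hM.nat_cases i with rfl | ⟨i, rfl⟩
  · exact .inl (hM.get_cons_zero a s)
  · exact .inr ⟨i, hM.lt_of_succ_lt_succ hi, hM.get_cons_succ a s i⟩

/-- Induction over finite sequences for internal formulas. -/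
theorem seq_ind {V : Ty → Type} {σ : Ty} (e : Env V M) (φ : Fml (Ext (.seq σ) V))
    (hφ : φ.Internal) (h0 : φ.Sat (e.cons (M.nil σ)))
    (hs : ∀ a s, φ.Sat (e.cons s) → φ.Sat (e.cons (M.cons a s))) (s : M.D (.seq σ)) :
    φ.Sat (e.cons s) := by
  -- Induction on the length, for all sequences of that length at once; the axiom of cases for
  -- sequences supplies the decomposition.
  have key := hM.ind e (.all (.seq σ) (.imp (.eq (.len Tm.v0) Tm.v1)
    (φ.bind (Sub.cons Tm.v0 Sub.wk2)))) ⟨trivial, hφ.bind _⟩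
  simp only [Fml.Sat, Fml.sat_bind, Sub.eval_cons, Sub.eval_wk2, Tm.eval_len, Tm.eval_v0,
    Tm.eval_v1] at key
  refine key (fun s h => ?_) (fun n ih s h => ?_) (M.len s) s rfl
  · rcases hM.seq_cases s with rfl | ⟨a, s, rfl⟩
    · exact h0
    · rw [hM.len_cons] at h
      exact (hM.succ_ne_zero _ h).elim
  · rcases hM.seq_cases s with rfl | ⟨a, s, rfl⟩
    · exact h0
    · rw [hM.len_cons] at h
      exact hs a s (ih s (hM.succ_inj h))

/-- The first component of a finite sequence. -/
theorem exists_head (σ : Ty) : ∃ t : Tm (fun _ => Empty) (.seq σ ⇾ σ),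
    ∀ a s, M.app (t.eval M.nilEnv) (M.cons a s) = a := by
  refine ⟨.lam (.recL Tm.v0 (Tm.dflt σ) (.lam (.lam (.lam Tm.v1)))), fun a s => ?_⟩
  rw [hM.beta, Tm.eval_recL, Tm.eval_v0, hM.recL_cons]
  simp only [hM.beta, Tm.eval_v1]

/-- The tail of a finite sequence. -/
theorem exists_tail (σ : Ty) : ∃ t : Tm (fun _ => Empty) (.seq σ ⇾ .seq σ),
    ∀ a s, M.app (t.eval M.nilEnv) (M.cons a s) = s := by
  refine ⟨.lam (.recL Tm.v0 (Tm.nil σ) (.lam (.lam (.lam Tm.v0)))), fun a s => ?_⟩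
  rw [hM.beta, Tm.eval_recL, Tm.eval_v0, hM.recL_cons]
  simp only [hM.beta, Tm.eval_v0]

/-- Mapping a function over a finite sequence. -/
theorem exists_map (σ τ : Ty) : ∃ t : Tm (fun _ => Empty) ((σ ⇾ τ) ⇾ .seq σ ⇾ .seq τ),
    ∀ f, M.app (M.app (t.eval M.nilEnv) f) (M.nil σ) = M.nil τ ∧
      ∀ a s, M.app (M.app (t.eval M.nilEnv) f) (M.cons a s) =
        M.cons (M.app f a) (M.app (M.app (t.eval M.nilEnv) f) s) := by
  refine ⟨.lam (.lam (.recL Tm.v0 (Tm.nil τ) (.lam (.lam (.lam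
    (.cons (.app (.wk Tm.v3) Tm.v1) Tm.v2)))))), fun f => ⟨?_, fun a s => ?_⟩⟩
  · simp only [hM.beta, Tm.eval_recL, Tm.eval_v0, hM.recL_nil, Tm.eval_nil]
  · simp only [hM.beta, Tm.eval_recL, Tm.eval_v0, hM.recL_cons, Tm.eval_cons, Tm.eval,
      Tm.eval_wk, Tm.eval_v1, Tm.eval_v2, Tm.eval_v3]
    rfl

/-- Induction over standard finite sequences for arbitrary formulas. -/
theorem seq_ind_st {V : Ty → Type} {σ : Ty} (e : Env V M) (Φ : Fml (Ext (.seq σ) V))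
    (h0 : Φ.Sat (e.cons (M.nil σ)))
    (hs : ∀ a s, M.st a → M.st s → Φ.Sat (e.cons s) → Φ.Sat (e.cons (M.cons a s)))
    (s : M.D (.seq σ)) (hst : M.st s) : Φ.Sat (e.cons s) := by
  have key := hM.ind_st e (.allst (.seq σ) (.imp (.eq (.len Tm.v0) Tm.v1)
    (Φ.bind (Sub.cons Tm.v0 Sub.wk2))))
  simp only [Fml.Sat, Fml.sat_bind, Sub.eval_cons, Sub.eval_wk2, Tm.eval_len, Tm.eval_v0,
    Tm.eval_v1] at key
  refine key (fun s _ h => ?_) (fun n _ ih s hst h => ?_) (M.len s) (hM.st_len hst) s hst rfl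
  · rcases hM.seq_cases s with rfl | ⟨a, s, rfl⟩
    · exact h0
    · rw [hM.len_cons] at h
      exact (hM.succ_ne_zero _ h).elim
  · rcases hM.seq_cases s with rfl | ⟨a, s, rfl⟩
    · exact h0
    · rw [hM.len_cons] at h
      -- Head and tail are given by closed terms, so both parts of a standard sequence are standard.
      obtain ⟨t₁, h₁⟩ := hM.exists_head σ
      obtain ⟨t₂, h₂⟩ := hM.exists_tail σ
      have ha := hM.st_app (hM.st_closed t₁) hst
      have hs' := hM.st_app (hM.st_closed t₂) hst
      rw [h₁] at ha
      rw [h₂] at hs'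
      exact hs a s ha hs' (ih s hs' (hM.succ_inj h))

end Model.Good

/-- Weakenings by four and five new variables, as substitutions. -/
def Sub.wk4 {V : Ty → Type} {σ τ ρ μ : Ty} : Sub V (Ext μ (Ext ρ (Ext τ (Ext σ V)))) :=
  fun _ x => Tm.var (Ext.succ (Ext.succ (Ext.succ (Ext.succ x))))

def Sub.wk5 {V : Ty → Type} {σ τ ρ μ ν : Ty} :
    Sub V (Ext ν (Ext μ (Ext ρ (Ext τ (Ext σ V))))) :=
  fun _ x => Tm.var (Ext.succ (Ext.succ (Ext.succ (Ext.succ (Ext.succ x)))))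

theorem Sub.eval_wk4 {M : Model} {V : Ty → Type} {σ τ ρ μ : Ty} (a : M.D σ) (b : M.D τ)
    (c : M.D ρ) (d : M.D μ) (e : Env V M) :
    (Sub.wk4 (σ := σ) (τ := τ) (ρ := ρ) (μ := μ)).eval
      ((((e.cons a).cons b).cons c).cons d) = e := rfl

theorem Sub.eval_wk5 {M : Model} {V : Ty → Type} {σ τ ρ μ ν : Ty} (a : M.D σ) (b : M.D τ)
    (c : M.D ρ) (d : M.D μ) (a' : M.D ν) (e : Env V M) :
    (Sub.wk5 (σ := σ) (τ := τ) (ρ := ρ) (μ := μ) (ν := ν)).eval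
      (((((e.cons a).cons b).cons c).cons d).cons a') = e := rfl

namespace Model.Good
variable {M : Model} (hM : M.Good)
include hM

/-! ### Pairing -/

/-- Any two types have a product type, with pairing and projections given by closed terms. -/
theorem exists_prod (σ τ : Ty) : ∃ (ρ : Ty) (p : Tm (fun _ => Empty) (σ ⇾ τ ⇾ ρ))
    (f : Tm (fun _ => Empty) (ρ ⇾ σ)) (g : Tm (fun _ => Empty) (ρ ⇾ τ)), ∀ x y,
      M.app (f.eval M.nilEnv) (M.app (M.app (p.eval M.nilEnv) x) y) = x ∧
      M.app (g.eval M.nilEnv) (M.app (M.app (p.eval M.nilEnv) x) y) = y := by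
  induction τ with
  | nat =>
    obtain ⟨hd, h_hd⟩ := hM.exists_head σ
    obtain ⟨tl, h_tl⟩ := hM.exists_tail σ
    -- The pair of x and n is the sequence of n + 1 copies of x. The extra copy keeps x recoverable
    -- when n is zero, and n is the length of the tail.
    refine ⟨.seq σ, .lam (.lam (.cons Tm.v1 (.recN Tm.v0 (Tm.nil σ)
      (.lam (.lam (.cons Tm.v3 Tm.v1)))))), hd, .lam (.len (.app tl.ofClosed Tm.v0)),
      fun x n => ?_⟩
    simp only [hM.beta, Tm.eval_cons, Tm.eval, Tm.eval_len, Tm.eval_ofClosed, Tm.eval_v0,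
      h_hd, h_tl, Tm.eval_v1, Tm.eval_recN, Tm.eval_nil, true_and]
    have key := hM.ind ((M.nilEnv.cons x).cons n) (.eq (.len (.recN Tm.v0 (Tm.nil σ)
      (Tm.wk (.lam (.lam (.cons Tm.v3 Tm.v1)))))) Tm.v0) trivial
    simp only [Fml.Sat, Tm.eval_len, Tm.eval_recN, Tm.eval_v0, Tm.eval_nil, Tm.eval_wk] at key
    refine key ?_ (fun m ih => ?_) n
    · rw [hM.recN_zero, hM.len_nil]
    · rw [hM.recN_succ, hM.beta, hM.beta, Tm.eval_cons, hM.len_cons, Tm.eval_v1, ih]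
  | arr a b _ ih =>
    obtain ⟨ρ, p, f, g, h⟩ := ih
    -- Pairing is pointwise: z is sent to the pair of x and y(z), and x is read off at the default
    -- argument.
    refine ⟨a ⇾ ρ, .lam (.lam (.lam (.app (.app p.ofClosed Tm.v2) (.app Tm.v1 Tm.v0)))),
      .lam (.app f.ofClosed (.app Tm.v0 (Tm.dflt a))),
      .lam (.lam (.app g.ofClosed (.app Tm.v1 Tm.v0))), fun x y => ⟨?_, hM.funext fun z => ?_⟩⟩
    · simp only [hM.beta, Tm.eval, Tm.eval_ofClosed, Tm.eval_v0, Tm.eval_v1, Tm.eval_v2, h]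
    · simp only [hM.beta, Tm.eval, Tm.eval_ofClosed, Tm.eval_v0, Tm.eval_v1, Tm.eval_v2, h]
  | seq b ih =>
    obtain ⟨ρ, p, f, g, h⟩ := ih
    obtain ⟨hd, h_hd⟩ := hM.exists_head ρ
    obtain ⟨tl, h_tl⟩ := hM.exists_tail ρ
    obtain ⟨m₁, h₁⟩ := hM.exists_map b ρ
    obtain ⟨m₂, h₂⟩ := hM.exists_map ρ b
    -- Each component of s is paired with x, behind an extra head pairing x with a default value, so
    -- that x survives when s is empty.
    refine ⟨.seq ρ, .lam (.lam (.cons (.app (.app p.ofClosed Tm.v1) (Tm.dflt b))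
      (.app (.app m₁.ofClosed (.app p.ofClosed Tm.v1)) Tm.v0))),
      .lam (.app f.ofClosed (.app hd.ofClosed Tm.v0)),
      .lam (.app (.app m₂.ofClosed g.ofClosed) (.app tl.ofClosed Tm.v0)), fun x s => ?_⟩
    simp only [hM.beta, Tm.eval_cons, Tm.eval, Tm.eval_ofClosed, Tm.eval_v0, Tm.eval_v1,
      h_hd, h_tl, h, true_and]
    have key := hM.seq_ind (M.nilEnv.cons x) (.eqAt (.seq b)
      (.app (.app m₂.ofClosed g.ofClosed)
        (.app (.app m₁.ofClosed (.app p.ofClosed Tm.v1)) Tm.v0)) Tm.v0) (Fml.internal_eqAt _ _ _)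
    simp only [hM.eqAt_iff, Tm.eval, Tm.eval_ofClosed, Tm.eval_v0, Tm.eval_v1] at key
    refine key ?_ (fun a s ih => ?_) s
    · rw [(h₁ _).1, (h₂ _).1]
    · rw [(h₁ _).2, (h₂ _).2, ih, (h _ _).2]

/-! ### Changing a function at one argument -/

theorem exists_natCases {σ : Ty} (x : M.D σ) (f : M.D (.nat ⇾ σ)) :
    ∃ g : M.D (.nat ⇾ σ), M.app g M.zero = x ∧ ∀ n, M.app g (M.succ n) = M.app f n := by
  refine ⟨(Tm.lam (.recN Tm.v0 Tm.v1 (.lam (.lam (.app (.wk (.wk Tm.v2)) Tm.v0))))).eval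
    ((M.nilEnv.cons f).cons x), ?_, fun n => ?_⟩
  · simp only [hM.beta, Tm.eval_recN, Tm.eval_v0, Tm.eval_v1, hM.recN_zero]
  · simp only [hM.beta, Tm.eval_recN, Tm.eval_v0, hM.recN_succ, Tm.eval, Tm.eval_wk,
      Tm.eval_v2]

theorem exists_shift {σ : Ty} (f : M.D (.nat ⇾ σ)) :
    ∃ g : M.D (.nat ⇾ σ), ∀ n, M.app g n = M.app f (M.succ n) := by
  refine ⟨(Tm.lam (.app Tm.v1 (.succ Tm.v0))).eval (M.nilEnv.cons f), fun n => ?_⟩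
  simp only [hM.beta, Tm.eval, Tm.eval_succ, Tm.eval_v0, Tm.eval_v1]

/-- Internal induction on n for all f at once: to change f at n + 1, change its shift at n and put
the value f(0) back in front. -/
theorem exists_update {σ : Ty} (f : M.D (.nat ⇾ σ)) (n : M.D .nat) (x : M.D σ) :
    ∃ g : M.D (.nat ⇾ σ), M.app g n = x ∧ ∀ m, m ≠ n → M.app g m = M.app f m := by
  have key := hM.ind (M.nilEnv.cons x) (.all (.nat ⇾ σ) (.ex (.nat ⇾ σ)
    (.and (.eqAt σ (.app Tm.v0 Tm.v2) Tm.v3) (.all .nat (.imp (.neg (.eq Tm.v0 Tm.v3))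
      (.eqAt σ (.app Tm.v1 Tm.v0) (.app Tm.v2 Tm.v0)))))))
    ⟨Fml.internal_eqAt _ _ _, ⟨trivial, trivial⟩, Fml.internal_eqAt _ _ _⟩
  simp only [Fml.Sat, Fml.sat_neg, hM.eqAt_iff, Tm.eval, Tm.eval_v0, Tm.eval_v1, Tm.eval_v2,
    Tm.eval_v3] at key
  refine key (fun f => ?_) (fun n ih f => ?_) n f
  · obtain ⟨f', hf'⟩ := hM.exists_shift f
    obtain ⟨g, h0, hs⟩ := hM.exists_natCases x f'
    refine ⟨g, h0, fun m hm => ?_⟩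
    rcases hM.nat_cases m with rfl | ⟨m, rfl⟩
    · exact (hm rfl).elim
    · rw [hs, hf']
  · obtain ⟨f', hf'⟩ := hM.exists_shift f
    obtain ⟨g', hn, hne⟩ := ih f'
    obtain ⟨g, h0, hs⟩ := hM.exists_natCases (M.app f M.zero) g'
    refine ⟨g, by rw [hs, hn], fun m hm => ?_⟩
    rcases hM.nat_cases m with rfl | ⟨m, rfl⟩
    · exact h0
    · rw [hs, hne m fun h => hm (congrArg _ h), hf']

end Model.Good

/-! ### Normal forms -/

/-- The external property `S` of assignments is of the form `∀st u ∃st v φ` with `φ` internal. -/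
def Model.NF (M : Model) {V : Ty → Type} (S : Env V M → Prop) : Prop :=
  ∃ (σ τ : Ty) (φ : Fml (Ext τ (Ext σ V))), φ.Internal ∧
    ∀ e, S e ↔ ∀ u, M.st u → ∃ v, M.st v ∧ φ.Sat ((e.cons u).cons v)

namespace Model.Good
variable {M : Model} (hM : M.Good) {V : Ty → Type}
include hM

/-- Herbrandised choice as an equivalence. -/
theorem hac_iff {σ τ : Ty} (e : Env V M) (φ : Fml (Ext τ (Ext σ V))) (hφ : φ.Internal) :
    (∀ u, M.st u → ∃ v, M.st v ∧ φ.Sat ((e.cons u).cons v)) ↔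
      ∃ F : M.D (σ ⇾ .seq τ), M.st F ∧
        ∀ u, M.st u → ∃ v, M.mem v (M.app F u) ∧ φ.Sat ((e.cons u).cons v) := by
  refine ⟨hM.hac e φ hφ, fun ⟨F, hF, h⟩ u hu => ?_⟩
  obtain ⟨v, hv, h⟩ := h u hu
  exact ⟨v, hM.st_of_mem (hM.st_app hF hu) hv, h⟩

/-- The dual of idealisation as an equivalence. -/
theorem ideal_iff {σ τ : Ty} (e : Env V M) (φ : Fml (Ext τ (Ext σ V))) (hφ : φ.Internal) :
    (∀ x, ∃ v, M.st v ∧ φ.Sat ((e.cons x).cons v)) ↔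
      ∃ s, M.st s ∧ ∀ x, ∃ v, M.mem v s ∧ φ.Sat ((e.cons x).cons v) := by
  constructor
  · intro h
    by_contra! hn
    have := hM.ideal e (.neg (φ.bind (Sub.cons Tm.v1 (Sub.cons Tm.v0 Sub.wk2))))
      ⟨hφ.bind _, trivial⟩
    simp only [Fml.sat_neg, Fml.sat_bind, Sub.eval_cons, Sub.eval_wk2, Tm.eval_v0,
      Tm.eval_v1] at this
    obtain ⟨x, hx⟩ := this hn
    obtain ⟨v, hv, h⟩ := h x
    exact hx v hv h
  · rintro ⟨s, hs, h⟩ x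
    obtain ⟨v, hv, h⟩ := h x
    exact ⟨v, hM.st_of_mem hs hv, h⟩

theorem nf_internal (φ : Fml V) (hφ : φ.Internal) : M.NF φ.Sat := by
  refine ⟨.nat, .nat, φ.bind Sub.wk2, hφ.bind _, fun e => ?_⟩
  simp only [Fml.sat_bind, Sub.eval_wk2]
  refine ⟨fun h _ _ => ⟨M.zero, hM.st_zero, h⟩, fun h => ?_⟩
  obtain ⟨_, _, h⟩ := h _ hM.st_zero
  exact h

/-- An object is standard when it equals some standard v; the universal quantifier is a dummy. -/
theorem nf_st {σ : Ty} (t : Tm V σ) : M.NF (Fml.st t).Sat := by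
  refine ⟨.nat, σ, .eqAt σ Tm.v0 t.wk.wk, Fml.internal_eqAt _ _ _, fun e => ?_⟩
  simp only [hM.eqAt_iff, Tm.eval_v0, Tm.eval_wk, Fml.Sat]
  refine ⟨fun h _ _ => ⟨_, h, rfl⟩, fun h => ?_⟩
  obtain ⟨v, hv, rfl⟩ := h _ hM.st_zero
  exact hv

/-- By `hac_iff`, S says ∃st F ∀st u ∃ v ∈ F(u) φ. Its negation is ∀st F ∃st u with the internal
matrix ∀ v ∈ F(u) ¬φ. -/
theorem nf_not {S : Env V M → Prop} (h : M.NF S) : M.NF fun e => ¬ S e := by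
  obtain ⟨σ, τ, φ, hφ, h⟩ := h
  refine ⟨σ ⇾ .seq τ, σ, .all τ (.imp (.mem Tm.v0 (.app Tm.v2 Tm.v1))
    (.neg (φ.bind (Sub.cons Tm.v0 (Sub.cons Tm.v1 Sub.wk3))))),
    ⟨Fml.internal_mem _ _, hφ.bind _, trivial⟩, fun e => ?_⟩
  simp only [Fml.Sat, Fml.sat_neg, Fml.sat_mem _ hM, Fml.sat_bind, Sub.eval_cons, Sub.eval_wk3,
    Tm.eval, Tm.eval_v0, Tm.eval_v1, Tm.eval_v2]
  rw [h, hM.hac_iff e φ hφ]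
  push Not
  rfl

/-- Both quantifier blocks are paired. If both disjuncts failed, at u and u', the witness for the
pair of u and u' would contradict one failure; conversely the unused component of the witness is a
default value. -/
theorem nf_or {S S' : Env V M → Prop} (h : M.NF S) (h' : M.NF S') :
    M.NF fun e => S e ∨ S' e := by
  obtain ⟨σ, τ, φ, hφ, h⟩ := h
  obtain ⟨σ', τ', φ', hφ', h'⟩ := h'
  obtain ⟨ρ, p, f, g, hρ⟩ := hM.exists_prod σ σ'
  obtain ⟨ρ', p', f', g', hρ'⟩ := hM.exists_prod τ τ'
  refine ⟨ρ, ρ', .or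
    (φ.bind (Sub.cons (.app f'.ofClosed Tm.v0) (Sub.cons (.app f.ofClosed Tm.v1) Sub.wk2)))
    (φ'.bind (Sub.cons (.app g'.ofClosed Tm.v0) (Sub.cons (.app g.ofClosed Tm.v1) Sub.wk2))),
    ⟨hφ.bind _, hφ'.bind _⟩, fun e => ?_⟩
  simp only [Fml.Sat, Fml.sat_bind, Sub.eval_cons, Sub.eval_wk2, Tm.eval, Tm.eval_ofClosed,
    Tm.eval_v0, Tm.eval_v1]
  rw [h, h']
  constructor
  · rintro (h | h) u hu
    · obtain ⟨v, hv, h⟩ := h _ (hM.st_app (hM.st_closed f) hu)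
      refine ⟨_, hM.st_app (hM.st_app (hM.st_closed p') hv) (hM.st_dflt τ'), .inl ?_⟩
      rwa [(hρ' _ _).1]
    · obtain ⟨v, hv, h⟩ := h _ (hM.st_app (hM.st_closed g) hu)
      refine ⟨_, hM.st_app (hM.st_app (hM.st_closed p') (hM.st_dflt τ)) hv, .inr ?_⟩
      rwa [(hρ' _ _).2]
  · intro h
    by_contra! hn
    obtain ⟨⟨u, hu, hn⟩, u', hu', hn'⟩ := hn
    obtain ⟨v, hv, h⟩ := h _ (hM.st_app (hM.st_app (hM.st_closed p) hu) hu')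
    rw [(hρ _ _).1, (hρ _ _).2] at h
    exact h.elim (hn _ (hM.st_app (hM.st_closed f') hv)) (hn' _ (hM.st_app (hM.st_closed g') hv))

/-- The quantifier over a commutes with ∀st u. For fixed u, `ideal_iff` replaces the witnesses v,
which depend on a, by one standard sequence containing a witness for every a. -/
theorem nf_all {σ : Ty} {S : Env (Ext σ V) M → Prop} (h : M.NF S) :
    M.NF fun e => ∀ a : M.D σ, S (e.cons a) := by
  obtain ⟨μ, τ, φ, hφ, h⟩ := h
  refine ⟨μ, .seq τ, .all σ (.ex τ (.and (.mem Tm.v0 Tm.v2)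
    (φ.bind (Sub.cons Tm.v0 (Sub.cons Tm.v3 (Sub.cons Tm.v1
      Sub.wk4)))))),
    ⟨Fml.internal_mem _ _, hφ.bind _⟩, fun e => ?_⟩
  simp only [Fml.Sat, Fml.sat_mem _ hM, Fml.sat_bind, Sub.eval_cons, Sub.eval_wk4,
    Tm.eval_v0, Tm.eval_v1, Tm.eval_v2, Tm.eval_v3, h]
  have key := fun u : M.D μ => hM.ideal_iff (e.cons u)
    (φ.bind (Sub.cons Tm.v0 (Sub.cons Tm.v2 (Sub.cons Tm.v1 Sub.wk3)))) (hφ.bind _)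
  simp only [Fml.sat_bind, Sub.eval_cons, Sub.eval_wk3, Tm.eval_v0, Tm.eval_v1,
    Tm.eval_v2] at key
  simp only [← key]
  exact ⟨fun h u hu a => h a u hu, fun h a u hu => h u hu a⟩

omit hM in
theorem nf_congr {S S' : Env V M → Prop} (h : M.NF S) (h' : ∀ e, S' e ↔ S e) : M.NF S' := by
  have : S' = S := _root_.funext fun e => propext (h' e)
  rwa [this]

/-- Every formula has a normal form. -/
theorem nf (Φ : Fml V) : M.NF Φ.Sat := by
  induction Φ with
  | eq s t => exact hM.nf_internal _ trivial
  | bot => exact hM.nf_internal _ trivial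
  | st t => exact hM.nf_st t
  | and φ ψ ih₁ ih₂ =>
    exact nf_congr (hM.nf_not (hM.nf_or (hM.nf_not ih₁) (hM.nf_not ih₂))) fun e => by
      rw [Fml.Sat]; tauto
  | or φ ψ ih₁ ih₂ => exact hM.nf_or ih₁ ih₂
  | imp φ ψ ih₁ ih₂ =>
    exact nf_congr (hM.nf_or (hM.nf_not ih₁) ih₂) fun e => imp_iff_not_or
  | all σ φ ih => exact hM.nf_all ih
  | ex σ φ ih =>
    exact nf_congr (hM.nf_not (hM.nf_all (hM.nf_not ih))) fun e => by
      rw [Fml.Sat]; push Not; rfl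
  | allst σ φ ih =>
    exact nf_congr (hM.nf_all (hM.nf_or (hM.nf_not (hM.nf_st Tm.v0)) ih)) fun e =>
      forall_congr' fun a => imp_iff_not_or
  | exst σ φ ih =>
    refine nf_congr (hM.nf_not (hM.nf_all (hM.nf_or (hM.nf_not (hM.nf_st Tm.v0))
      (hM.nf_not ih)))) fun e => ?_
    rw [Fml.Sat]
    push Not
    rfl

/-! ### Countable saturation -/

/-- Countable saturation for conditions `∀st u ψ` with `ψ` internal. -/
theorem saturation {σ α : Ty} (e : Env V M) (ψ : Fml (Ext α (Ext σ (Ext .nat V))))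
    (hψ : ψ.Internal)
    (h : ∀ n, M.st n → ∃ x, ∀ u, M.st u → ψ.Sat (((e.cons n).cons x).cons u)) :
    ∃ f : M.D (.nat ⇾ σ), ∀ n, M.st n → ∀ u, M.st u →
      ψ.Sat (((e.cons n).cons (M.app f n)).cons u) := by
  obtain ⟨ρ, p, fst, snd, hρ⟩ := hM.exists_prod .nat α
  -- Idealisation has one standard parameter, so n and u are coded as the projections of a single
  -- object.
  have key := hM.ideal e (σ := ρ) (τ := .nat ⇾ σ) (ψ.bind (Sub.cons (.app snd.ofClosed Tm.v1)
    (Sub.cons (.app Tm.v0 (.app fst.ofClosed Tm.v1))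
      (Sub.cons (.app fst.ofClosed Tm.v1) Sub.wk2)))) (hψ.bind _)
  -- The finite case is proved in a stronger form: at each listed n the value f(n) meets the
  -- condition for all standard u, not only for the listed one. This formula is external, hence the
  -- induction over standard sequences.
  have hfin := hM.seq_ind_st e (σ := ρ) (.ex (.nat ⇾ σ) (.all ρ (.imp (.mem Tm.v0 Tm.v2)
    (.allst α (ψ.bind (Sub.cons Tm.v0 (Sub.cons (.app Tm.v2 (.app fst.ofClosed Tm.v1))
      (Sub.cons (.app fst.ofClosed Tm.v1)
        Sub.wk4))))))))
  simp only [Fml.Sat, Fml.sat_mem _ hM, Fml.sat_bind, Sub.eval_cons, Sub.eval_wk4, Sub.eval_wk2, Tm.eval,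
    Tm.eval_ofClosed, Tm.eval_v0, Tm.eval_v1, Tm.eval_v2] at key hfin
  obtain ⟨f, hf⟩ := key fun s hs => by
    obtain ⟨f, hf⟩ := hfin ⟨M.dflt _, fun x hx => (hM.not_mem_nil x hx).elim⟩
      (fun a s ha _ ⟨f, hf⟩ => by
        obtain ⟨y, hy⟩ := h _ (hM.st_app (hM.st_closed fst) ha)
        obtain ⟨g, hg, hne⟩ := hM.exists_update f (M.app (fst.eval M.nilEnv) a) y
        refine ⟨g, fun x hx u hu => ?_⟩
        -- Earlier entries may share the first component with a. Overwriting the value there does no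
        -- harm, as y is good for every standard u.
        by_cases hxa : M.app (fst.eval M.nilEnv) x = M.app (fst.eval M.nilEnv) a
        · rw [hxa, hg]
          exact hy u hu
        · rw [hne _ hxa]
          rcases hM.mem_cons hx with rfl | hx
          · exact (hxa rfl).elim
          · exact hf x hx u hu) s hs
    exact ⟨f, fun x hx => hf x hx _ (hM.st_app (hM.st_closed snd) (hM.st_of_mem hs hx))⟩
  refine ⟨f, fun n hn u hu => ?_⟩
  have := hf _ (hM.st_app (hM.st_app (hM.st_closed p) hn) hu)
  rwa [(hρ _ _).1, (hρ _ _).2] at this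

/-- Countable saturation holds in all models. -/
theorem sat_csat {σ : Ty} (Φ : Fml (Ext σ (Ext .nat V))) (e : Env V M) : (csat Φ).Sat e := by
  simp only [csat, Fml.Sat, Fml.sat_bind, Sub.eval_cons, Sub.eval_wk2, Tm.eval, Tm.eval_v0,
    Tm.eval_v1]
  intro h
  obtain ⟨α, β, φ, hφ, hnf⟩ := hM.nf Φ
  simp only [hnf] at h ⊢
  -- Choice is applied to the standard bounding function F, with the possibly nonstandard x kept
  -- under an existential quantifier. The condition contains ∀st u, so choice for external formulas
  -- is needed here.
  have hch := hM.choice e (σ := α ⇾ .seq β) (.ex σ (.allst α (.ex β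
    (.and (.mem Tm.v0 (.app Tm.v3 Tm.v1)) (φ.bind (Sub.cons Tm.v0 (Sub.cons Tm.v1
      (Sub.cons Tm.v2 (Sub.cons (.wk Tm.v3) Sub.wk5)))))))))
  simp only [Fml.Sat, Fml.sat_mem _ hM, Fml.sat_bind, Sub.eval_cons, Sub.eval_wk5, Tm.eval,
    Tm.eval_wk, Tm.eval_v0, Tm.eval_v1, Tm.eval_v2, Tm.eval_v3] at hch
  obtain ⟨G, hG, hGn⟩ := hch fun n hn => by
    obtain ⟨x, hx⟩ := h n hn
    obtain ⟨F, hF, hx⟩ := hM.hac _ φ hφ hx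
    exact ⟨F, hF, x, hx⟩
  -- With G a parameter, the search for v is bounded by G(n)(u), which makes the matrix internal.
  have hsat := hM.saturation (e.cons G) (σ := σ) (α := α) (.ex β
    (.and (.mem Tm.v0 (.app (.app (.wk Tm.v3) Tm.v3) Tm.v1)) (φ.bind (Sub.cons Tm.v0
      (Sub.cons Tm.v1 (Sub.cons Tm.v2 (Sub.cons Tm.v3 Sub.wk5)))))))
    ⟨Fml.internal_mem _ _, hφ.bind _⟩
  simp only [Fml.Sat, Fml.sat_mem _ hM, Fml.sat_bind, Sub.eval_cons, Sub.eval_wk5, Tm.eval,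
    Tm.eval_wk, Tm.eval_v0, Tm.eval_v1, Tm.eval_v2, Tm.eval_v3] at hsat
  obtain ⟨f, hf⟩ := hsat hGn
  refine ⟨f, fun n hn u hu => ?_⟩
  obtain ⟨v, hv, hx⟩ := hf n hn u hu
  exact ⟨v, hM.st_of_mem (hM.st_app (hM.st_app hG hn) hu) hv, hx⟩

end Model.Good

end NSArith

/-! ### From truth in all models to derivability -/

theorem mainTheorem3 :
    ∀ A ∈ NSArith.CSAT NSArith.Vars, (NSArith.P.union NSArith.AC0st).Proves A := by
  rintro A ⟨σ, Φ, rfl⟩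
  exact NSArith.proves_of_forall_model fun M hM e => hM.sat_csat Φ e
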